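/- **Theorem (Ball-box theorem for free vector fields).** Let $r\ge 2$, let $\Omega\subseteq\mathbb R^p$ be open and connected, and let $X_0,X_1,\dots,X_n$ be $C^\infty$ vector fields on $\Omega$. Give $X_0$ weight $p_0=2$ and $X_1,\dots,X_n$ weight $p_i=1$. For a nonempty multiindex $I=(i_1,\dots,i_k)$, $i_j\in\{0,\dots,n\}$, put $|I|=\sum_j p_{i_j}$ and $X_{[I]}=[X_{i_1},[X_{i_2},\dots[X_{i_{k-1}},X_{i_k}]\dots]]$ (with $X_{[(i)]}=X_i$). Let $A_{IJ}$ be the universal constants with $X_{[I]}=\sum_J A_{IJ}X_{j_1}\cdots X_{j_l}$, $J=(j_1,\dots,j_l)$, i.e. $A_{IJ}$ is the coefficient of the monomial $\xi_{j_1}\cdots\xi_{j_l}$ in the iterated commutator $\xi_{[I]}$ of the noncommuting variables $\xi_0,\dots,\xi_n$. Assume that at every $x\in\Omega$: - (free up to weight $r$) for all real constants $(a_I)_{|I|\le r}$, if $\sum_{|I|\le r}a_I (X_{[I]})_x=0$, then $\sum_{|I|\le r}a_IA_{IJ}=0$ for all $J$; - (Hörmander's condition of step $r$) the vectors $(X_{[I]})_x$,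 $|I|\le r$, span $\mathbb R^p$. Fix a set $B$ of multiindices $I$ with $|I|\le r$ such that $\{(X_{[I]})_x\}_{I\in B}$ is a basis of $\mathbb R^p$ for every $x\in\Omega$, and let $Q=\sum_{I\in B}|I|$. For $u=(u_I)_{I\in B}$ let $\exp\bigl(\sum_{I\in B}u_IX_{[I]}\bigr)(\bar x)=\varphi(1)$, where $\varphi:[0,1]\to\Omega$ solves $\varphi'=\sum_{I\in B}u_I(X_{[I]})_{\varphi}$, $\varphi(0)=\bar x$ (if this solution exists on $[0,1]$), and let $$\mathrm{Box}(\bar x,R)=\Bigl\{\exp\Bigl(\sum_{I\in B}u_IX_{[I]}\Bigr)(\bar x):\ |u_I|<R^{|I|}\ \text{for all } I\in B\Bigr\}.$$ Let $S$ be either $B$ or the set of all multiindices with $|I|\le r$. For $x,y\in\Omega$ let $d(x,y)$ be the infimum of the $\delta>0$ for which there is an absolutely continuous curve $\varphi:[0,1]\to\Omega$ with $\varphi(0)=x$, $\varphi(1)=y$ and $\varphi'(t)=\sum_{I\in S}a_I(t)(X_{[I]})_{\varphi(t)}$ for a.e. $t$, where $|a_I(t)|\le\delta^{|I|}$. Let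 $B(\bar x,R)=\{y\in\Omega: d(\bar x,y)<R\}$, and let $|E|$ denote the Lebesgue measure of $E$. Then for every $\Omega'\Subset\Omega$ there are constants $C\ge1$ and $R_0,c_1,c_2,c_3>0$ such that, for every $\bar x\in\Omega'$, every $0<R\le R_0$ and both choices of $S$, the exponentials $\exp\bigl(\sum_{I\in B}u_IX_{[I]}\bigr)(\bar x)$ exist for all $u$ with $|u_I|<(CR)^{|I|}$ $(I\in B)$, and 1. $\mathrm{Box}(\bar x,R)\subseteq B(\bar x,R)\subseteq \mathrm{Box}(\bar x,CR)$; 2. $c_1R^Q\le |B(\bar x,R)|\le c_2R^Q$; 3. $|B(\bar x,2R)|\le c_3|B(\bar x,R)|$. -/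

import Mathlib

open Set Filter Topology MeasureTheory
open scoped ENNReal NNReal ContDiff

namespace BallBox

/-- A multiindex `I = (i₁, …, i_k)` with entries in `{0, 1, …, n}`; genuine multiindices are the
nonempty lists. -/
abbrev MultiIndex (n : ℕ) : Type := List (Fin (n + 1))

/-- The weight of a single index: `p₀ = 2` and `p_i = 1` for `i = 1, …, n`. -/
def indexWeight {n : ℕ} (i : Fin (n + 1)) : ℕ := if i = 0 then 2 else 1

/-- The weight `|I| = p_{i₁} + ⋯ + p_{i_k}` of a multiindex. -/
def weight {n : ℕ} (I : MultiIndex n) : ℕ := (I.map indexWeight).sum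

theorem length_le_weight {n : ℕ} (I : MultiIndex n) : I.length ≤ weight I := by
  induction I with
  | nil => simp
  | cons i I ih =>
    have h : 1 ≤ indexWeight i := by unfold indexWeight; split_ifs <;> norm_num
    have h2 : weight (i :: I) = indexWeight i + weight I := by simp [weight]
    rw [h2, List.length_cons]
    omega

theorem finite_multiIndex (n s : ℕ) :
    {I : MultiIndex n | I ≠ [] ∧ weight I ≤ s}.Finite :=
  (List.finite_length_le (Fin (n + 1)) s).subset
    fun I hI => (length_le_weight I).trans hI.2

/-- The finite set of all (nonempty) multiindices `I` with `|I| ≤ s`. -/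
noncomputable def indicesUpTo (n s : ℕ) : Finset (MultiIndex n) := (finite_multiIndex n s).toFinset

theorem mem_indicesUpTo {n s : ℕ} {I : MultiIndex n} :
    I ∈ indicesUpTo n s ↔ I ≠ [] ∧ weight I ≤ s := by
  simp [indicesUpTo]

/-- The vector field `X_[I] = [X_{i₁}, [X_{i₂}, … [X_{i_{k-1}}, X_{i_k}] … ]]`, with
`X_[(i)] = X_i`. (The value at the empty list is never used.) -/
noncomputable def bracket {E : Type*} [NormedAddCommGroup E] [NormedSpace ℝ E] {n : ℕ}
    (X : Fin (n + 1) → E → E) : MultiIndex n → E → E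
  | [] => 0
  | [i] => X i
  | i :: j :: I => VectorField.lieBracket ℝ (X i) (bracket X (j :: I))

/-- The formal commutator `ξ_[I]` in the noncommutative polynomials (free associative algebra)
in the variables `ξ₀, …, ξ_n`. -/
noncomputable def formalBracket {n : ℕ} : MultiIndex n → MonoidAlgebra ℝ (FreeMonoid (Fin (n + 1)))
  | [] => 0
  | [i] => MonoidAlgebra.single (FreeMonoid.of i) 1
  | i :: j :: I =>
      MonoidAlgebra.single (FreeMonoid.of i) 1 * formalBracket (j :: I)
        - formalBracket (j :: I) * MonoidAlgebra.single (FreeMonoid.of i) 1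

/-- The universal constants `A_{IJ}` with `X_[I] = ∑_J A_{IJ} X_J`, `X_J = X_{j₁} ⋯ X_{j_k}`:
the coefficient of the monomial `ξ_J` in `ξ_[I]`. -/
noncomputable def bracketCoeff {n : ℕ} (I J : MultiIndex n) : ℝ :=
  (formalBracket I).coeff (FreeMonoid.ofList J)

/-- `X₀, …, X_n` are free up to weight `s` at `x`. -/
def FreeUpToWeightAt {E : Type*} [NormedAddCommGroup E] [NormedSpace ℝ E] {n : ℕ}
    (X : Fin (n + 1) → E → E) (s : ℕ) (x : E) : Prop :=
  ∀ a : MultiIndex n → ℝ, ∑ I ∈ indicesUpTo n s, a I • bracket X I x = 0 →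
    ∀ J : MultiIndex n, ∑ I ∈ indicesUpTo n s, a I * bracketCoeff I J = 0

/-- Hörmander's condition of (weighted) step `r` at `x`. -/
def HormanderAt {E : Type*} [NormedAddCommGroup E] [NormedSpace ℝ E] {n : ℕ}
    (X : Fin (n + 1) → E → E) (r : ℕ) (x : E) : Prop :=
  Submodule.span ℝ ((fun I => bracket X I x) '' (indicesUpTo n r : Set (MultiIndex n))) = ⊤

/-- The vectors `(X_[I])_x`, `I ∈ B`, form a basis of the space. -/
def IsBracketBasisAt {E : Type*} [NormedAddCommGroup E] [NormedSpace ℝ E] {n : ℕ}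
    (X : Fin (n + 1) → E → E) (B : Finset (MultiIndex n)) (x : E) : Prop :=
  LinearIndependent ℝ (fun I : B => bracket X I x) ∧
    Submodule.span ℝ (range fun I : B => bracket X I x) = ⊤

/-- `IsExp Ω Y x y`: the point `exp(Y)(x)` exists (in `Ω`) and equals `y`, i.e. the solution of
`φ' = Y_φ`, `φ(0) = x` exists on `[0,1]`, with values in `Ω`, and `φ(1) = y`. -/
def IsExp {E : Type*} [NormedAddCommGroup E] [NormedSpace ℝ E] (Ω : Set E) (Y : E → E)
    (x y : E) : Prop :=
  ∃ φ : ℝ → E, φ 0 = x ∧ φ 1 = y ∧ (∀ t ∈ Icc (0 : ℝ) 1, φ t ∈ Ω) ∧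
    IsIntegralCurveOn φ (fun _ => Y) (Icc 0 1)

/-- `Box(x, R)`: the points `exp(∑_{I ∈ B} u_I X_[I])(x)` with `|u_I| < R^|I|` for `I ∈ B`. -/
def box {E : Type*} [NormedAddCommGroup E] [NormedSpace ℝ E] {n : ℕ} (Ω : Set E)
    (X : Fin (n + 1) → E → E) (B : Finset (MultiIndex n)) (x : E) (R : ℝ) : Set E :=
  {y | ∃ u : MultiIndex n → ℝ, (∀ I ∈ B, |u I| < R ^ weight I) ∧
    IsExp Ω (fun z => ∑ I ∈ B, u I • bracket X I z) x y}

/-- The class `C(δ)` of absolutely continuous curves `φ : [0,1] → Ω` with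
`φ' = ∑_{I ∈ S} a_I(t) (X_[I])_φ` a.e. and `|a_I(t)| ≤ δ^|I|`. -/
def IsAdmissible {E : Type*} [NormedAddCommGroup E] [NormedSpace ℝ E] {n : ℕ} (Ω : Set E)
    (X : Fin (n + 1) → E → E) (S : Finset (MultiIndex n)) (δ : ℝ) (φ : ℝ → E) : Prop :=
  AbsolutelyContinuousOnInterval φ 0 1 ∧ (∀ t ∈ Icc (0 : ℝ) 1, φ t ∈ Ω) ∧
    ∃ a : MultiIndex n → ℝ → ℝ,
      (∀ I ∈ S, ∀ t ∈ Icc (0 : ℝ) 1, |a I t| ≤ δ ^ weight I) ∧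
      ∀ᵐ t ∂(volume.restrict (Icc (0 : ℝ) 1)),
        HasDerivAt φ (∑ I ∈ S, a I t • bracket X I (φ t)) t

/-- The subelliptic distance on `Ω` induced by `{X_[I]}_{I ∈ S}`: the infimum of the `δ > 0` for
which some curve of class `C(δ)` joins `x` to `y` (`∞` if there is none). -/
noncomputable def subellipticDist {E : Type*} [NormedAddCommGroup E] [NormedSpace ℝ E] {n : ℕ}
    (Ω : Set E) (X : Fin (n + 1) → E → E) (S : Finset (MultiIndex n)) (x y : E) : ℝ≥0∞ :=
  sInf (ENNReal.ofReal ''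
    {δ : ℝ | 0 < δ ∧ ∃ φ : ℝ → E, IsAdmissible Ω X S δ φ ∧ φ 0 = x ∧ φ 1 = y})

/-- The open ball of the subelliptic distance. -/
def subellipticBall {E : Type*} [NormedAddCommGroup E] [NormedSpace ℝ E] {n : ℕ}
    (Ω : Set E) (X : Fin (n + 1) → E → E) (S : Finset (MultiIndex n)) (x : E) (R : ℝ) : Set E :=
  {y | subellipticDist Ω X S x y < ENNReal.ofReal R}

end BallBox

/-! Freeness makes the frame of basis brackets graded. Each formal commutator is homogeneous for the
weight. So a linear relation between brackets at one point first becomes a formal relation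
(freeness), then splits into one formal relation per weight, and each of these holds again for the
vector fields, because formal commutators act as the corresponding derivations. Hence `X_[L]`
expands in the basis with terms of weight `|L|` only (`eq_zero_of_bracket_eq_sum`). With the Jacobi
identity, `[X_[I], X_[K]]` for `I, K ∈ B` has no component of weight above `|I| + |K|`
(`exists_lieBracket_eq_sum`). After the dilation `u_I ↦ u_I / R^|I|` the structure coefficients
therefore stay bounded uniformly in `R ≤ 1`; this is the field `bracket` of `LocalFrame`.

The inclusion of the box in the ball is immediate: an exponential curve is admissible with constant
coefficients. For the other inclusion, an admissible curve `φ` is written as `φ(t) = exp(u(t))(x)`,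
which is possible because `exp` is a small perturbation of an invertible linear map, and one must
show that `u` stays in a box. Compare the trajectories of two parameters `u, v` by the coordinates
`m(s)` of their difference in the moving frame. Then `m' = (v - u) - c + O(|v - u|²)`, where `c`
represents the commutator of the fields with constant coefficients `u` and `m(s)`. The grading and
Grönwall's inequality give `norm_dilate_sub_le`: the dilated `v - u` is at most twice the dilated
coordinates of the endpoint difference, up to a quadratic error. Difference quotients along `φ`
remove that error, and continuous induction keeps the dilated `u(t)` small
(`exists_trajectory_one_eq_of_curve`). No derivative of `exp` in its parameters is needed.

The volume bounds follow since `exp` is bi-Lipschitz on a coordinate box of volume `2^p R^Q`;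
doubling follows from the two bounds. -/

namespace BallBox

/-! ### Weights, formal commutators and graded structure coefficients -/

section Algebra

variable {E : Type*} [NormedAddCommGroup E] [NormedSpace ℝ E] {n : ℕ} {Ω : Set E}
  {X : Fin (n + 1) → E → E}

theorem weight_cons (i : Fin (n + 1)) (I : MultiIndex n) :
    weight (i :: I) = indexWeight i + weight I := by
  simp [weight]

theorem two_le_infty : (2 : WithTop ℕ∞) ≤ (∞ : WithTop ℕ∞) :=
  WithTop.coe_le_coe.2 (le_top : (2 : ℕ∞) ≤ ⊤)

theorem contDiffOn_lieBracket (hΩ : IsOpen Ω) {V W : E → E} (hV : ContDiffOn ℝ ∞ V Ω)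
    (hW : ContDiffOn ℝ ∞ W Ω) : ContDiffOn ℝ ∞ (VectorField.lieBracket ℝ V W) Ω := fun x hx =>
  (((hV.contDiffAt (hΩ.mem_nhds hx)).lieBracket_vectorField
    (hW.contDiffAt (hΩ.mem_nhds hx)) (by simp)).contDiffWithinAt)

theorem contDiffOn_bracket (hΩ : IsOpen Ω) (hX : ∀ i, ContDiffOn ℝ ∞ (X i) Ω) :
    ∀ I : MultiIndex n, ContDiffOn ℝ ∞ (bracket X I) Ω
  | [] => contDiffOn_const
  | [i] => hX i
  | i :: j :: I => contDiffOn_lieBracket hΩ (hX i) (contDiffOn_bracket hΩ hX (j :: I))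

theorem lieBracket_bracket (i : Fin (n + 1)) {K : MultiIndex n} (hK : K ≠ []) :
    VectorField.lieBracket ℝ (X i) (bracket X K) = bracket X (i :: K) := by
  cases K with
  | nil => exact absurd rfl hK
  | cons k K => rfl

/-- The constant-coefficient combinations of the iterated brackets of weight `w`. -/
def weightSpan (X : Fin (n + 1) → E → E) (w : ℕ) : Submodule ℝ (E → E) :=
  Submodule.span ℝ {V | ∃ L : MultiIndex n, L ≠ [] ∧ weight L = w ∧ bracket X L = V}

theorem bracket_mem_weightSpan {L : MultiIndex n} (hL : L ≠ []) {w : ℕ} (hw : weight L = w) :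
    bracket X L ∈ weightSpan X w :=
  Submodule.subset_span ⟨L, hL, hw, rfl⟩

theorem contDiffOn_of_mem_weightSpan (hΩ : IsOpen Ω) (hX : ∀ i, ContDiffOn ℝ ∞ (X i) Ω) {w : ℕ}
    {V : E → E} (hV : V ∈ weightSpan X w) : ContDiffOn ℝ ∞ V Ω := by
  induction hV using Submodule.span_induction with
  | mem V h =>
    obtain ⟨L, -, -, rfl⟩ := h
    exact contDiffOn_bracket hΩ hX L
  | zero => exact contDiffOn_const
  | add V W _ _ hV hW => exact hV.add hW
  | smul a V _ hV => exact hV.const_smul a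

/-- Additivity of the Lie bracket needs differentiability, which is known on `Ω` only; hence `EqOn`
instead of an equality of functions. -/
theorem exists_eqOn_lieBracket_generator (hΩ : IsOpen Ω) (hX : ∀ i, ContDiffOn ℝ ∞ (X i) Ω)
    (i : Fin (n + 1)) {w : ℕ} {V : E → E} (hV : V ∈ weightSpan X w) :
    ∃ W ∈ weightSpan X (indexWeight i + w), EqOn (VectorField.lieBracket ℝ (X i) V) W Ω := by
  have hd : ∀ {V : E → E}, V ∈ weightSpan X w → ∀ x ∈ Ω, DifferentiableAt ℝ V x := fun hV x hx =>
    ((contDiffOn_of_mem_weightSpan hΩ hX hV).contDiffAt (hΩ.mem_nhds hx)).differentiableAt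
      (by simp)
  induction hV using Submodule.span_induction with
  | mem V h =>
    obtain ⟨L, hL, hw, rfl⟩ := h
    exact ⟨bracket X (i :: L), bracket_mem_weightSpan (by simp) (by rw [weight_cons, hw]),
      by rw [lieBracket_bracket i hL]; exact fun _ _ => rfl⟩
  | zero => exact ⟨0, zero_mem _, by rw [VectorField.lieBracket_zero_right]; exact fun _ _ => rfl⟩
  | add V W hV hW ihV ihW =>
    obtain ⟨V', hV', eV⟩ := ihV
    obtain ⟨W', hW', eW⟩ := ihW
    refine ⟨V' + W', add_mem hV' hW', fun x hx => ?_⟩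
    rw [VectorField.lieBracket_add_right (hd hV x hx) (hd hW x hx), eV hx, eW hx, Pi.add_apply]
  | smul a V hV ihV =>
    obtain ⟨V', hV', eV⟩ := ihV
    refine ⟨a • V', Submodule.smul_mem _ _ hV', fun x hx => ?_⟩
    rw [VectorField.lieBracket_const_smul_right (hd hV x hx), eV hx, Pi.smul_apply]

/-- A commutator of iterated brackets is, by the Jacobi identity, a combination with constant
coefficients of iterated brackets of the same total weight. -/
theorem exists_eqOn_lieBracket_bracket (hΩ : IsOpen Ω) (hX : ∀ i, ContDiffOn ℝ ∞ (X i) Ω) :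
    ∀ I : MultiIndex n, I ≠ [] → ∀ K : MultiIndex n, K ≠ [] →
      ∃ W ∈ weightSpan X (weight I + weight K),
        EqOn (VectorField.lieBracket ℝ (bracket X I) (bracket X K)) W Ω
  | [], h, _, _ => absurd rfl h
  | [i], _, K, hK => ⟨bracket X (i :: K),
      bracket_mem_weightSpan (by simp) (by simp [weight]),
      by rw [← lieBracket_bracket i hK]; exact fun _ _ => rfl⟩
  | i :: j :: I, _, K, hK => by
    -- Jacobi: `[[X_i, P], Z] = [X_i, [P, Z]] - [P, [X_i, Z]]`. The last term moves a letter from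
    -- the left word to the right one, so the recursion is on the left word with the right one
    -- arbitrary.
    obtain ⟨V, hV, eV⟩ := exists_eqOn_lieBracket_bracket hΩ hX (j :: I) (by simp) K hK
    obtain ⟨V', hV', eV'⟩ := exists_eqOn_lieBracket_generator hΩ hX i hV
    obtain ⟨W, hW, eW⟩ :=
      exists_eqOn_lieBracket_bracket hΩ hX (j :: I) (by simp) (i :: K) (by simp)
    have e1 : weight (i :: j :: I) + weight K = indexWeight i + (weight (j :: I) + weight K) := by
      rw [weight_cons i (j :: I)]; ring
    have e2 : weight (j :: I) + weight (i :: K)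
        = indexWeight i + (weight (j :: I) + weight K) := by
      rw [weight_cons i K]; ring
    rw [e2] at hW
    rw [e1]
    refine ⟨V' - W, sub_mem hV' hW, fun x hx => ?_⟩
    have hc : ∀ L, ContDiffAt ℝ ∞ (bracket X L) x := fun L =>
      (contDiffOn_bracket hΩ hX L).contDiffAt (hΩ.mem_nhds hx)
    have key := VectorField.leibniz_identity_lieBracket (𝕜 := ℝ) (n := ∞)
      (by simpa using two_le_infty) ((hX i).contDiffAt (hΩ.mem_nhds hx)) (hc (j :: I)) (hc K)
    have h1 : VectorField.lieBracket ℝ (X i)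
        (VectorField.lieBracket ℝ (bracket X (j :: I)) (bracket X K)) x = V' x := by
      rw [← eV' hx]
      exact Filter.EventuallyEq.lieBracket_vectorField_eq EventuallyEq.rfl
        (eV.eventuallyEq_of_mem (hΩ.mem_nhds hx))
    rw [h1, lieBracket_bracket i hK, eW hx] at key
    rw [Pi.sub_apply, key, add_sub_cancel_right]
    rfl

/-- The functions `E → ℝ` that are smooth on `Ω`. -/
def smoothFunctionsOn (Ω : Set E) : Submodule ℝ (E → ℝ) where
  carrier := {f | ContDiffOn ℝ ∞ f Ω}
  add_mem' hf hg := ContDiffOn.add hf hg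
  zero_mem' := contDiffOn_const
  smul_mem' a _ hf := ContDiffOn.const_smul a hf

/-- Outside `Ω` the derivative of a function smooth only on `Ω` need not be additive in the
function. Cutting it off there makes the derivation linear on functions defined on all of `E`. -/
theorem contDiffOn_indicator_fderiv_apply (hΩ : IsOpen Ω) {V : E → E} (hV : ContDiffOn ℝ ∞ V Ω)
    {f : E → ℝ} (hf : ContDiffOn ℝ ∞ f Ω) :
    ContDiffOn ℝ ∞ (Ω.indicator fun x => fderiv ℝ f x (V x)) Ω :=
  ((hf.fderiv_of_isOpen hΩ (m := ∞) (by simp)).clm_apply hV).congr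
    fun _ hx => indicator_of_mem hx _

/-- A vector field as a derivation of the functions that are smooth on `Ω`. -/
noncomputable def derivAlong (hΩ : IsOpen Ω) (V : E → E) (hV : ContDiffOn ℝ ∞ V Ω) :
    Module.End ℝ (smoothFunctionsOn Ω) where
  toFun f := ⟨Ω.indicator fun x => fderiv ℝ f.1 x (V x),
    contDiffOn_indicator_fderiv_apply hΩ hV f.2⟩
  map_add' f g := by
    ext x
    by_cases hx : x ∈ Ω
    · have hd : ∀ f : smoothFunctionsOn Ω, DifferentiableAt ℝ f.1 x := fun f =>
        (f.2.contDiffAt (hΩ.mem_nhds hx)).differentiableAt (by simp)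
      simp [hx, fderiv_add (hd f) (hd g)]
    · simp [hx]
  map_smul' a f := by
    ext x
    by_cases hx : x ∈ Ω
    · have hd : DifferentiableAt ℝ f.1 x :=
        (f.2.contDiffAt (hΩ.mem_nhds hx)).differentiableAt (by simp)
      simp [hx, fderiv_const_smul hd a]
    · simp [hx]

theorem derivAlong_apply (hΩ : IsOpen Ω) {V : E → E} (hV : ContDiffOn ℝ ∞ V Ω)
    (f : smoothFunctionsOn Ω) {x : E} (hx : x ∈ Ω) :
    (derivAlong hΩ V hV f).1 x = fderiv ℝ f.1 x (V x) :=
  indicator_of_mem hx fun x => fderiv ℝ f.1 x (V x)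

/-- The action of noncommutative polynomials in `X₀, …, X_n` on smooth functions. -/
noncomputable def operatorHom (hΩ : IsOpen Ω) (hX : ∀ i, ContDiffOn ℝ ∞ (X i) Ω) :
    MonoidAlgebra ℝ (FreeMonoid (Fin (n + 1))) →ₐ[ℝ] Module.End ℝ (smoothFunctionsOn Ω) :=
  MonoidAlgebra.lift ℝ _ _ (FreeMonoid.lift fun i => derivAlong hΩ (X i) (hX i))

theorem operatorHom_single (hΩ : IsOpen Ω) (hX : ∀ i, ContDiffOn ℝ ∞ (X i) Ω) (i : Fin (n + 1)) :
    operatorHom hΩ hX (MonoidAlgebra.single (FreeMonoid.of i) 1) = derivAlong hΩ (X i) (hX i) := by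
  simp [operatorHom]

/-- The universal identity `X_[I] = ∑_J A_{IJ} X_J` of differential operators. -/
theorem operatorHom_formalBracket (hΩ : IsOpen Ω) (hX : ∀ i, ContDiffOn ℝ ∞ (X i) Ω) :
    ∀ I : MultiIndex n, operatorHom hΩ hX (formalBracket I)
      = derivAlong hΩ (bracket X I) (contDiffOn_bracket hΩ hX I)
  | [] => by
    ext f x
    by_cases hx : x ∈ Ω
    · rw [derivAlong_apply _ _ _ hx]; simp [formalBracket, bracket]
    · simp [formalBracket, derivAlong, hx]
  | [i] => operatorHom_single hΩ hX i
  | i :: j :: I => by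
    ext f x
    rw [formalBracket, map_sub, map_mul, map_mul, operatorHom_single,
      operatorHom_formalBracket hΩ hX (j :: I)]
    by_cases hx : x ∈ Ω
    · rw [derivAlong_apply _ _ _ hx, bracket]
      have hc : ∀ L, DifferentiableAt ℝ (bracket X L) x := fun L =>
        ((contDiffOn_bracket hΩ hX L).contDiffAt (hΩ.mem_nhds hx)).differentiableAt (by simp)
      rw [VectorField.fderiv_apply_lieBracket (n := ∞) (f.2.contDiffAt (hΩ.mem_nhds hx))
        (by simpa using two_le_infty) (hc (j :: I)) (V := X i) (hc [i])]
      have hcongr : ∀ (V : E → E) (hV : ContDiffOn ℝ ∞ V Ω),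
          fderiv ℝ (derivAlong hΩ V hV f).1 x = fderiv ℝ (fun y => fderiv ℝ f.1 y (V y)) x :=
        fun V hV => Filter.EventuallyEq.fderiv_eq
          (eventuallyEq_of_mem (hΩ.mem_nhds hx) fun y hy => derivAlong_apply hΩ hV f hy)
      rw [LinearMap.sub_apply, Submodule.coe_sub, Pi.sub_apply, Module.End.mul_apply,
        Module.End.mul_apply, derivAlong_apply _ _ _ hx, derivAlong_apply _ _ _ hx, hcongr, hcongr]
    · simp [derivAlong, hx]

/-- A linear relation between the formal commutators is satisfied by the vector fields. -/
theorem sum_smul_bracket_eq_zero (hΩ : IsOpen Ω) (hX : ∀ i, ContDiffOn ℝ ∞ (X i) Ω)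
    (s : Finset (MultiIndex n)) (a : MultiIndex n → ℝ)
    (ha : ∀ J : MultiIndex n, ∑ I ∈ s, a I * bracketCoeff I J = 0) {x : E} (hx : x ∈ Ω) :
    ∑ I ∈ s, a I • bracket X I x = 0 := by
  have h0 : ∑ I ∈ s, a I • formalBracket I = 0 := by
    ext m
    have := ha (FreeMonoid.toList m)
    simpa [bracketCoeff, MonoidAlgebra.coeff_sum, Finsupp.finsetSum_apply] using this
  -- Continuous functionals suffice as test functions: the derivation along `V` sends `ℓ` to `ℓ ∘ V`
  -- on `Ω`.
  refine SeparatingDual.eq_zero_of_forall_dual_eq_zero (R := ℝ) fun ℓ => ?_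
  have h1 : operatorHom hΩ hX (∑ I ∈ s, a I • formalBracket I) = 0 := by rw [h0, map_zero]
  have h2 := congrFun (congrArg Subtype.val
    (LinearMap.congr_fun h1 ⟨ℓ, ℓ.contDiff.contDiffOn⟩)) x
  simp only [map_sum, map_smul, operatorHom_formalBracket, LinearMap.sum_apply,
    LinearMap.smul_apply, Submodule.coe_sum, Submodule.coe_smul, Finset.sum_apply, Pi.smul_apply,
    derivAlong_apply hΩ _ _ hx, ContinuousLinearMap.fderiv, LinearMap.zero_apply] at h2
  simpa using h2

theorem coeff_mul_eq_zero_of_weight_ne {f g : MonoidAlgebra ℝ (FreeMonoid (Fin (n + 1)))} {v w : ℕ}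
    (hf : ∀ m, weight (FreeMonoid.toList m) ≠ v → f.coeff m = 0)
    (hg : ∀ m, weight (FreeMonoid.toList m) ≠ w → g.coeff m = 0) {m : FreeMonoid (Fin (n + 1))}
    (hm : weight (FreeMonoid.toList m) ≠ v + w) : (f * g).coeff m = 0 := by
  classical
  rw [MonoidAlgebra.coeff_mul]
  refine Finset.sum_eq_zero fun a _ => Finset.sum_eq_zero fun b _ => ?_
  beta_reduce
  split_ifs with hab
  · by_contra hne
    obtain ⟨ha, hb⟩ := mul_ne_zero_iff.1 hne
    refine hm ?_
    rw [← not_imp_comm.1 (hf a) ha, ← not_imp_comm.1 (hg b) hb, ← hab]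
    simp [weight, FreeMonoid.toList_mul]
  · rfl

theorem coeff_single_eq_zero_of_weight_ne (i : Fin (n + 1)) (m : FreeMonoid (Fin (n + 1)))
    (hm : weight (FreeMonoid.toList m) ≠ indexWeight i) :
    (MonoidAlgebra.single (FreeMonoid.of i) (1 : ℝ)).coeff m = 0 := by
  classical
  rw [MonoidAlgebra.coeff_single, Finsupp.single_apply, if_neg]
  rintro rfl
  exact hm (by simp [FreeMonoid.toList_of, weight])

theorem coeff_formalBracket_eq_zero : ∀ (I : MultiIndex n) (m : FreeMonoid (Fin (n + 1))),
    weight (FreeMonoid.toList m) ≠ weight I → (formalBracket I).coeff m = 0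
  | [], m, _ => by simp [formalBracket]
  | [i], m, h => coeff_single_eq_zero_of_weight_ne i m (by simpa [weight] using h)
  | i :: j :: I, m, h => by
    rw [weight_cons] at h
    rw [formalBracket, MonoidAlgebra.coeff_sub, Finsupp.sub_apply,
      coeff_mul_eq_zero_of_weight_ne (coeff_single_eq_zero_of_weight_ne i)
        (coeff_formalBracket_eq_zero (j :: I)) h,
      coeff_mul_eq_zero_of_weight_ne (coeff_formalBracket_eq_zero (j :: I))
        (coeff_single_eq_zero_of_weight_ne i) (by rw [add_comm (weight _)]; exact h), sub_zero]

/-- Homogeneity of `ξ_[I]`: this is what lets a formal relation be split by weight. -/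
theorem bracketCoeff_eq_zero {I J : MultiIndex n} (h : weight J ≠ weight I) :
    bracketCoeff I J = 0 :=
  coeff_formalBracket_eq_zero I _ (by simpa using h)

/-- The coefficients are a difference of two indicators so that `L` itself may belong to `B`. -/
theorem sum_indicator_smul {ι F : Type*} [DecidableEq ι] [AddCommGroup F] [Module ℝ F]
    {s B : Finset ι} {L : ι}
    (hL : L ∈ s) (hB : B ⊆ s) (c : ι → ℝ) (v : ι → F) :
    ∑ I ∈ s, ((if I = L then 1 else 0) - if I ∈ B then c I else 0) • v I
      = v L - ∑ I ∈ B, c I • v I := by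
  simp only [sub_smul, Finset.sum_sub_distrib, ite_smul, one_smul, zero_smul,
    Finset.sum_ite_eq', hL, if_true]
  rw [← Finset.sum_filter, Finset.filter_mem_eq_inter, Finset.inter_eq_right.2 hB]

/-- Freeness: in the expansion of `X_[L]`, `|L| ≤ s`, in the basis only brackets of the same weight
occur. -/
theorem eq_zero_of_bracket_eq_sum (hΩ : IsOpen Ω) (hX : ∀ i, ContDiffOn ℝ ∞ (X i) Ω) {s : ℕ}
    {x : E} (hx : x ∈ Ω) (hfree : FreeUpToWeightAt X s x) {B : Finset (MultiIndex n)}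
    (hB : B ⊆ indicesUpTo n s) (hbasis : IsBracketBasisAt X B x) {L : MultiIndex n}
    (hL : L ∈ indicesUpTo n s) {c : MultiIndex n → ℝ}
    (hc : bracket X L x = ∑ J ∈ B, c J • bracket X J x) {J : MultiIndex n} (hJ : J ∈ B)
    (hJL : weight J ≠ weight L) : c J = 0 := by
  classical
  have hformal : ∀ J' : MultiIndex n,
      bracketCoeff L J' - ∑ I ∈ B, c I * bracketCoeff I J' = 0 := by
    intro J'
    have h1 := hfree (fun I => (if I = L then 1 else 0) - if I ∈ B then c I else 0)
      (by rw [sum_indicator_smul hL hB, hc, sub_self]) J'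
    have h2 := sum_indicator_smul hL hB c fun I => bracketCoeff I J'
    simp only [smul_eq_mul] at h2
    rw [← h2, h1]
  -- The component of weight `|J|` of the formal relation does not involve `ξ_[L]`. Transferred back
  -- to the fields it is a relation between basis vectors alone, so its coefficients vanish.
  have hrel : ∑ I ∈ B, (if weight I = weight J then c I else 0) • bracket X I x = 0 := by
    refine sum_smul_bracket_eq_zero hΩ hX B _ (fun J' => ?_) hx
    by_cases hw : weight J' = weight J
    · have h1 := hformal J'
      rw [bracketCoeff_eq_zero (by rw [hw]; exact hJL), zero_sub, neg_eq_zero] at h1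
      rw [← h1]
      refine Finset.sum_congr rfl fun I _ => ?_
      split_ifs with hI
      · rfl
      · rw [bracketCoeff_eq_zero (by rw [hw]; exact Ne.symm hI), mul_zero, mul_zero]
    · refine Finset.sum_eq_zero fun I _ => ?_
      split_ifs with hI
      · rw [bracketCoeff_eq_zero (by rw [hI]; exact hw), mul_zero]
      · rw [zero_mul]
  rw [← Finset.sum_coe_sort] at hrel
  have := Fintype.linearIndependent_iff.1 hbasis.1 _ hrel ⟨J, hJ⟩
  simpa using this

theorem exists_eq_sum_bracket {x : E} {B : Finset (MultiIndex n)}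
    (hbasis : IsBracketBasisAt X B x) (v : E) :
    ∃ c : MultiIndex n → ℝ, v = ∑ J ∈ B, c J • bracket X J x := by
  classical
  have hv : v ∈ Submodule.span ℝ (range fun I : B => bracket X I x) := by
    rw [hbasis.2]; trivial
  obtain ⟨c, rfl⟩ := (Submodule.mem_span_range_iff_exists_fun ℝ).1 hv
  refine ⟨fun J => if h : J ∈ B then c ⟨J, h⟩ else 0, ?_⟩
  rw [← Finset.sum_coe_sort B]
  exact Finset.sum_congr rfl fun J _ => by simp

/-- The coefficients of `X_[L]`, `|L| ≤ s`, with respect to the basis vanish on heavier brackets. -/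
theorem exists_bracket_eq_sum (hΩ : IsOpen Ω) (hX : ∀ i, ContDiffOn ℝ ∞ (X i) Ω) {s : ℕ}
    {x : E} (hx : x ∈ Ω) (hfree : FreeUpToWeightAt X s x) {B : Finset (MultiIndex n)}
    (hB : B ⊆ indicesUpTo n s) (hbasis : IsBracketBasisAt X B x) {L : MultiIndex n}
    (hL : L ∈ indicesUpTo n s) :
    ∃ c : MultiIndex n → ℝ, bracket X L x = ∑ J ∈ B, c J • bracket X J x ∧
      ∀ J ∈ B, weight L < weight J → c J = 0 := by
  obtain ⟨c, hc⟩ := exists_eq_sum_bracket hbasis (bracket X L x)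
  exact ⟨c, hc, fun J hJ hlt =>
    eq_zero_of_bracket_eq_sum hΩ hX hx hfree hB hbasis hL hc hJ hlt.ne'⟩

theorem exists_eq_sum_of_mem_weightSpan (hΩ : IsOpen Ω) (hX : ∀ i, ContDiffOn ℝ ∞ (X i) Ω) {s : ℕ}
    {x : E} (hx : x ∈ Ω) (hfree : FreeUpToWeightAt X s x) {B : Finset (MultiIndex n)}
    (hB : B ⊆ indicesUpTo n s) (hbasis : IsBracketBasisAt X B x) {w : ℕ} (hw : w ≤ s) {V : E → E}
    (hV : V ∈ weightSpan X w) :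
    ∃ c : MultiIndex n → ℝ, V x = ∑ J ∈ B, c J • bracket X J x ∧
      ∀ J ∈ B, w < weight J → c J = 0 := by
  induction hV using Submodule.span_induction with
  | mem V h =>
    obtain ⟨L, hL, rfl, rfl⟩ := h
    exact exists_bracket_eq_sum hΩ hX hx hfree hB hbasis (mem_indicesUpTo.2 ⟨hL, hw⟩)
  | zero => exact ⟨0, by simp, fun _ _ _ => rfl⟩
  | add V W _ _ hV hW =>
    obtain ⟨c, hc, hc0⟩ := hV
    obtain ⟨d, hd, hd0⟩ := hW
    refine ⟨c + d, ?_, fun J hJ hlt => by simp [hc0 J hJ hlt, hd0 J hJ hlt]⟩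
    rw [Pi.add_apply, hc, hd, ← Finset.sum_add_distrib]
    simp only [Pi.add_apply, add_smul]
  | smul a V _ hV =>
    obtain ⟨c, hc, hc0⟩ := hV
    refine ⟨a • c, ?_, fun J hJ hlt => by simp [hc0 J hJ hlt]⟩
    rw [Pi.smul_apply, hc, Finset.smul_sum]
    simp only [Pi.smul_apply, smul_smul, smul_eq_mul]

/-- The commutator of two fields of the basis is a combination of fields of the basis whose weight
is at most the sum of the weights. -/
theorem exists_lieBracket_eq_sum (hΩ : IsOpen Ω) (hX : ∀ i, ContDiffOn ℝ ∞ (X i) Ω) {s : ℕ}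
    {x : E} (hx : x ∈ Ω) (hfree : FreeUpToWeightAt X s x) {B : Finset (MultiIndex n)}
    (hB : B ⊆ indicesUpTo n s) (hbasis : IsBracketBasisAt X B x) {I K : MultiIndex n}
    (hI : I ∈ B) (hK : K ∈ B) :
    ∃ c : MultiIndex n → ℝ,
      VectorField.lieBracket ℝ (bracket X I) (bracket X K) x = ∑ J ∈ B, c J • bracket X J x ∧
      ∀ J ∈ B, weight I + weight K < weight J → c J = 0 := by
  rcases le_or_gt (weight I + weight K) s with hw | hw
  · obtain ⟨W, hW, eW⟩ := exists_eqOn_lieBracket_bracket hΩ hX I (mem_indicesUpTo.1 (hB hI)).1 K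
      (mem_indicesUpTo.1 (hB hK)).1
    rw [eW hx]
    exact exists_eq_sum_of_mem_weightSpan hΩ hX hx hfree hB hbasis hw hW
  -- Above weight `s` the condition on `c` is vacuous, since `B` has no multiindex heavier than `s`.
  · obtain ⟨c, hc⟩ := exists_eq_sum_bracket hbasis
      (VectorField.lieBracket ℝ (bracket X I) (bracket X K) x)
    refine ⟨c, hc, fun J hJ hlt => ?_⟩
    have := (mem_indicesUpTo.1 (hB hJ)).2
    omega

end Algebra

/-! ### Absolutely continuous curves, continuous induction and Grönwall -/

section Curves

theorem absolutelyContinuousOnInterval_of_dist_le {A B : Type*} [PseudoMetricSpace A]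
    [PseudoMetricSpace B] {f : ℝ → A} {g : ℝ → B} {a b C : ℝ}
    (hf : AbsolutelyContinuousOnInterval f a b)
    (h : ∀ s ∈ uIcc a b, ∀ t ∈ uIcc a b, dist (g s) (g t) ≤ C * dist (f s) (f t)) :
    AbsolutelyContinuousOnInterval g a b := by
  have hlim : Tendsto (fun e : ℕ × (ℕ → ℝ × ℝ) =>
      C * ∑ i ∈ Finset.range e.1, dist (f (e.2 i).1) (f (e.2 i).2))
      (AbsolutelyContinuousOnInterval.totalLengthFilter ⊓
        𝓟 (AbsolutelyContinuousOnInterval.disjWithin a b)) (𝓝 0) := by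
    simpa using Tendsto.const_mul C hf
  refine squeeze_zero' (Eventually.of_forall fun e => Finset.sum_nonneg fun _ _ => dist_nonneg)
    ?_ hlim
  filter_upwards [mem_inf_of_right (mem_principal_self _)] with e he
  rw [Finset.mul_sum]
  exact Finset.sum_le_sum fun i hi => h _ (he.1 i hi).1 _ (he.1 i hi).2

/-- A functional that norms `f T - f 0` reduces the claim to the fundamental theorem of calculus for
real absolutely continuous functions. -/
theorem AbsolutelyContinuousOnInterval.norm_sub_le {F : Type*} [NormedAddCommGroup F]
    [NormedSpace ℝ F] {f : ℝ → F} {T C : ℝ} (hT : 0 ≤ T)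
    (hf : AbsolutelyContinuousOnInterval f 0 T)
    (hd : ∀ᵐ t ∂(volume.restrict (Icc (0 : ℝ) T)), ∃ v, HasDerivAt f v t ∧ ‖v‖ ≤ C) :
    ‖f T - f 0‖ ≤ C * T := by
  obtain ⟨g, hg1, hg⟩ := exists_dual_vector'' ℝ (f T - f 0)
  have hac : AbsolutelyContinuousOnInterval (fun t => g (f t)) 0 T := by
    refine absolutelyContinuousOnInterval_of_dist_le (C := ‖g‖) hf fun s _ t _ => ?_
    rw [dist_eq_norm, dist_eq_norm, ← map_sub]
    exact g.le_opNorm _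
  have hint := hac.integral_deriv_eq_sub
  have hae : ∀ᵐ t, t ∈ uIoc 0 T → ‖deriv (fun t => g (f t)) t‖ ≤ C := by
    rw [ae_restrict_iff' measurableSet_Icc] at hd
    filter_upwards [hd] with t ht hmem
    rw [uIoc_of_le hT] at hmem
    obtain ⟨v, hv, hvC⟩ := ht (Ioc_subset_Icc_self hmem)
    have hgv : HasDerivAt (fun t => g (f t)) (g v) t := g.hasFDerivAt.comp_hasDerivAt t hv
    rw [hgv.deriv]
    calc ‖g v‖ ≤ ‖g‖ * ‖v‖ := g.le_opNorm v
      _ ≤ 1 * ‖v‖ := by gcongr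
      _ ≤ C := by rwa [one_mul]
  have hle := intervalIntegral.norm_integral_le_of_norm_le_const_ae hae
  rw [hint, ← map_sub, hg, sub_zero, abs_of_nonneg hT] at hle
  simpa using hle

/-- Continuous induction: a continuous function that satisfies `g T < ρ` as soon as `g ≤ ρ` on
`[0, T]` stays below `ρ`. -/
theorem lt_of_forall_le_imp_lt {g : ℝ → ℝ} {ρ : ℝ} (hg : ContinuousOn g (Icc 0 1))
    (h : ∀ T ∈ Icc (0 : ℝ) 1, (∀ t ∈ Icc 0 T, t < T → g t ≤ ρ) → g T < ρ) :
    ∀ t ∈ Icc (0 : ℝ) 1, g t < ρ := by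
  by_contra! hcon
  obtain ⟨t₀, ht₀, hρ⟩ := hcon
  have hclosed : IsCompact {t ∈ Icc (0 : ℝ) 1 | ρ ≤ g t} := by
    have : {t ∈ Icc (0 : ℝ) 1 | ρ ≤ g t} = Icc 0 1 ∩ g ⁻¹' Ici ρ := rfl
    rw [this]
    exact isCompact_Icc.of_isClosed_subset
      (hg.preimage_isClosed_of_isClosed isClosed_Icc isClosed_Ici)
      inter_subset_left
  obtain ⟨T, ⟨hT, hgT⟩, hmin⟩ := hclosed.exists_isLeast ⟨t₀, ht₀, hρ⟩
  refine absurd (h T hT fun t ht htT => ?_) (not_lt.2 hgT)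
  by_contra! hlt
  exact absurd (hmin ⟨⟨ht.1, htT.le.trans hT.2⟩, hlt.le⟩) (not_le.2 htT)

/-- Grönwall with rate 1 gives `ε (e^s - 1)`, and `e ≤ 3`. -/
theorem norm_le_of_norm_deriv_le_add {F : Type*} [NormedAddCommGroup F] [NormedSpace ℝ F]
    {f f' : ℝ → F} {ε : ℝ} (h0 : f 0 = 0) (hε : 0 ≤ ε)
    (hf : ∀ s ∈ Icc (0 : ℝ) 1, HasDerivWithinAt f (f' s) (Icc 0 1) s)
    (hle : ∀ s ∈ Icc (0 : ℝ) 1, ‖f' s‖ ≤ ‖f s‖ + ε) :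
    ∀ s ∈ Icc (0 : ℝ) 1, ‖f s‖ ≤ 2 * ε := by
  intro s hs
  have h := norm_le_gronwallBound_of_norm_deriv_right_le (δ := 0) (K := 1) (ε := ε)
    (fun s hs => (hf s hs).continuousWithinAt)
    (fun s hs => (hf s (Ico_subset_Icc_self hs)).mono_of_mem_nhdsWithin
      (Icc_mem_nhdsGE_of_mem hs)) (by simp [h0])
    (fun s hs => by simpa using hle s (Ico_subset_Icc_self hs)) s hs
  rw [gronwallBound_of_K_ne_0 one_ne_zero] at h
  simp only [zero_mul, zero_add, one_mul, div_one, sub_zero] at h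
  have he : Real.exp s ≤ 3 :=
    (Real.exp_le_exp.2 hs.2).trans (by linarith [Real.exp_one_lt_d9])
  nlinarith

end Curves

/-! ### Volume under Lipschitz maps -/

section Volume

variable {ι : Type*} [Fintype ι] {p : ℕ}

theorem volume_eq_volume_image_ofLp (S : Set (EuclideanSpace ℝ (Fin p))) :
    volume S = volume ((fun y : EuclideanSpace ℝ (Fin p) => WithLp.ofLp y) '' S) := by
  have h := (EuclideanSpace.volume_preserving_symm_measurableEquiv_toLp
    (Fin p)).measure_preimage_equiv ((fun y => WithLp.ofLp y) '' S)
  rw [← h]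
  congr 1
  exact ((MeasurableEquiv.toLp 2 (Fin p → ℝ)).symm.injective.preimage_image S).symm

/-- In the sup metric, Lebesgue measure is the `p`-dimensional Hausdorff measure, which a Lipschitz
map multiplies by at most `K ^ p` without any differentiability. -/
theorem volume_image_le (hcard : Fintype.card ι = p) {K : ℝ≥0}
    {f : (ι → ℝ) → EuclideanSpace ℝ (Fin p)} {A : Set (ι → ℝ)} (hf : LipschitzOnWith K f A) :
    volume (f '' A) ≤ (K : ℝ≥0∞) ^ p * volume A := by
  rw [volume_eq_volume_image_ofLp, image_image, ← hausdorffMeasure_pi_real,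
    ← hausdorffMeasure_pi_real, hcard, Fintype.card_fin]
  have h2 : LipschitzOnWith K (fun u => WithLp.ofLp (f u)) A := by
    have := (PiLp.lipschitzWith_ofLp 2 (fun _ : Fin p => ℝ)).comp_lipschitzOnWith hf
    rwa [one_mul] at this
  simpa using h2.hausdorffMeasure_image_le (d := p) (by positivity)

/-- The Hausdorff measure bound is applied to the inverse map on the image; the factor `√p` compares
the Euclidean norm with the sup norm. -/
theorem volume_le_image (hcard : Fintype.card ι = p) {K : ℝ≥0}
    {f : (ι → ℝ) → EuclideanSpace ℝ (Fin p)} {A : Set (ι → ℝ)}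
    (hf : ∀ u ∈ A, ∀ v ∈ A, dist u v ≤ K * dist (f u) (f v)) :
    volume A ≤ ((K * (p : ℝ≥0) ^ (1 / 2 : ℝ) : ℝ≥0) : ℝ≥0∞) ^ p * volume (f '' A) := by
  classical
  set F : (ι → ℝ) → Fin p → ℝ := fun u => WithLp.ofLp (f u) with hF
  have hdist : ∀ u ∈ A, ∀ v ∈ A,
      dist u v ≤ (K * (p : ℝ≥0) ^ (1 / 2 : ℝ) : ℝ≥0) * dist (F u) (F v) := by
    intro u hu v hv
    have h := (PiLp.antilipschitzWith_ofLp 2 (fun _ : Fin p => ℝ)).le_mul_dist (f u) (f v)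
    have h' : dist (f u) (f v) ≤ ((p : ℝ≥0) ^ (1 / 2 : ℝ) : ℝ≥0) * dist (F u) (F v) := by
      simpa using h
    calc dist u v ≤ K * dist (f u) (f v) := hf u hu v hv
      _ ≤ K * (((p : ℝ≥0) ^ (1 / 2 : ℝ) : ℝ≥0) * dist (F u) (F v)) := by gcongr
      _ = _ := by rw [NNReal.coe_mul, mul_assoc]
  have hinj : InjOn F A := fun u hu v hv huv => by
    have := hdist u hu v hv
    rw [huv, dist_self, mul_zero] at this
    exact dist_le_zero.1 this
  have hleft := hinj.leftInvOn_invFunOn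
  have hlip : LipschitzOnWith (K * (p : ℝ≥0) ^ (1 / 2 : ℝ)) (Function.invFunOn F A) (F '' A) := by
    refine LipschitzOnWith.of_dist_le_mul ?_
    rintro _ ⟨u, hu, rfl⟩ _ ⟨v, hv, rfl⟩
    rw [hleft hu, hleft hv]
    exact hdist u hu v hv
  have h := hlip.hausdorffMeasure_image_le (d := p) (by positivity)
  have himg : Function.invFunOn F A '' (F '' A) = A := by
    rw [image_image]
    exact (image_congr hleft).trans (image_id' A)
  rw [himg] at h
  rw [volume_eq_volume_image_ofLp, image_image, ← hausdorffMeasure_pi_real,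
    ← hausdorffMeasure_pi_real, hcard, Fintype.card_fin]
  simpa using h

theorem volume_setOf_abs_lt (r : ι → ℝ) :
    volume {u : ι → ℝ | ∀ i, |u i| < r i} = ∏ i, ENNReal.ofReal (2 * r i) := by
  have : {u : ι → ℝ | ∀ i, |u i| < r i} = univ.pi fun i => Ioo (-r i) (r i) := by
    ext u; simp [abs_lt]
  rw [this, Real.volume_pi_Ioo]
  congr with i
  ring_nf

end Volume

/-- The anisotropic dilation `u_i ↦ u_i / R ^ w_i`. -/
noncomputable def dilate {ι : Type*} (w : ι → ℕ) (R : ℝ) : (ι → ℝ) →L[ℝ] (ι → ℝ) :=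
  ContinuousLinearMap.pi fun i => (R ^ w i)⁻¹ • ContinuousLinearMap.proj i

@[simp] theorem dilate_apply {ι : Type*} (w : ι → ℕ) (R : ℝ) (u : ι → ℝ) (i : ι) :
    dilate w R u i = u i / R ^ w i := by
  simp [dilate, div_eq_inv_mul]

/-! ### Uniformly controlled frames and their exponential maps -/

section Frame

variable {ι : Type*} [Fintype ι] {E : Type*} [NormedAddCommGroup E] [NormedSpace ℝ E]

/-- The linear map `u ↦ ∑ i, u_i Y_i(z)`. -/
noncomputable def comb (Y : ι → E → E) (z : E) : (ι → ℝ) →L[ℝ] E :=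
  ∑ i, (ContinuousLinearMap.proj i : (ι → ℝ) →L[ℝ] ℝ).smulRight (Y i z)

theorem comb_apply (Y : ι → E → E) (z : E) (u : ι → ℝ) : comb Y z u = ∑ i, u i • Y i z := by
  simp [comb]

/-- Uniform bounds, on the ball `closedBall x ρ`, for a frame `Y` of vector fields with weights `w`
whose commutators are combinations of fields of at most the total weight. -/
structure LocalFrame (Y : ι → E → E) (w : ι → ℕ) (x : E) (ρ M : ℝ) : Prop where
  one_le : 1 ≤ M
  radius_pos : 0 < ρ
  contDiffAt : ∀ z ∈ Metric.closedBall x ρ, ContDiffAt ℝ 1 (comb Y) z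
  isInvertible : ∀ z ∈ Metric.closedBall x ρ, (comb Y z).IsInvertible
  norm_le : ∀ z ∈ Metric.closedBall x ρ, ∀ u, ‖comb Y z u‖ ≤ M * ‖u‖
  norm_le_comb : ∀ z ∈ Metric.closedBall x ρ, ∀ u, ‖u‖ ≤ M * ‖comb Y z u‖
  norm_sub_le : ∀ z ∈ Metric.closedBall x ρ, ∀ z' ∈ Metric.closedBall x ρ, ∀ u,
    ‖comb Y z' u - comb Y z u‖ ≤ M * ‖u‖ * ‖z' - z‖
  taylor : ∀ z ∈ Metric.closedBall x ρ, ∀ z' ∈ Metric.closedBall x ρ, ∀ u,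
    ‖comb Y z' u - comb Y z u - fderiv ℝ (comb Y) z (z' - z) u‖ ≤ M * ‖u‖ * ‖z' - z‖ ^ 2
  -- The difference is the commutator of the constant-coefficient fields `∑ u_i Y_i` and `∑ m_i
  -- Y_i`. The point is that `M` does not depend on `R`.
  bracket : ∀ z ∈ Metric.closedBall x ρ, ∀ u m : ι → ℝ, ∃ c : ι → ℝ,
    fderiv ℝ (comb Y) z (comb Y z u) m - fderiv ℝ (comb Y) z (comb Y z m) u = comb Y z c ∧
    ∀ R : ℝ, 0 < R → R ≤ 1 → ‖dilate w R c‖ ≤ M * ‖dilate w R u‖ * ‖dilate w R m‖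

/-- An integral curve on `[0, 1]` of the field `∑ i, u_i Y_i` that starts at `x` and stays in
`closedBall x ρ`. -/
structure IsTrajectory (Y : ι → E → E) (x : E) (ρ : ℝ) (u : ι → ℝ) (W : ℝ → E) : Prop where
  zero : W 0 = x
  deriv : ∀ s ∈ Icc (0 : ℝ) 1, HasDerivWithinAt W (comb Y (W s) u) (Icc 0 1) s
  mem : ∀ s ∈ Icc (0 : ℝ) 1, W s ∈ Metric.closedBall x ρ

/-- The size of the parameters for which the exponential map is controlled. -/
noncomputable def expRadius (ρ M : ℝ) : ℝ := min (ρ / M) (1 / (8 * M ^ 3))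

variable {Y : ι → E → E} {w : ι → ℕ} {x : E} {ρ M : ℝ}

namespace LocalFrame

theorem pos (h : LocalFrame Y w x ρ M) : 0 < M := zero_lt_one.trans_le h.one_le

theorem expRadius_pos (h : LocalFrame Y w x ρ M) : 0 < expRadius ρ M := by
  have := h.pos
  have := h.radius_pos
  unfold expRadius
  positivity

theorem mul_expRadius_le (h : LocalFrame Y w x ρ M) : M * expRadius ρ M ≤ ρ := by
  have h1 : expRadius ρ M ≤ ρ / M := min_le_left _ _
  rw [le_div_iff₀ h.pos] at h1
  linarith

theorem cube_mul_expRadius_le (h : LocalFrame Y w x ρ M) : 8 * M ^ 3 * expRadius ρ M ≤ 1 := by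
  have h1 : expRadius ρ M ≤ 1 / (8 * M ^ 3) := min_le_right _ _
  rw [le_div_iff₀ (by have := h.pos; positivity)] at h1
  linarith

theorem mul_expRadius_le_one (h : LocalFrame Y w x ρ M) : M * expRadius ρ M ≤ 1 := by
  have h1 := h.cube_mul_expRadius_le
  have h2 : M ≤ M ^ 3 := le_self_pow₀ h.one_le (by norm_num)
  nlinarith [h.expRadius_pos, h.pos]

theorem exists_isTrajectory [CompleteSpace E] (h : LocalFrame Y w x ρ M) {u : ι → ℝ}
    (hu : ‖u‖ ≤ expRadius ρ M) : ∃ W, IsTrajectory Y x ρ u W := by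
  have hM := h.pos
  have hL : M * ‖u‖ ≤ ρ := (by gcongr : M * ‖u‖ ≤ M * expRadius ρ M).trans h.mul_expRadius_le
  obtain ⟨a, rfl⟩ : ∃ a : ℝ≥0, (a : ℝ) = ρ := ⟨⟨ρ, h.radius_pos.le⟩, rfl⟩
  obtain ⟨L, hL'⟩ : ∃ L : ℝ≥0, (L : ℝ) = M * ‖u‖ := ⟨⟨M * ‖u‖, by positivity⟩, rfl⟩
  have hpl : IsPicardLindelof (fun _ z => comb Y z u) (tmin := 0) (tmax := 1)
      ⟨0, by simp⟩ x a 0 L L :=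
    IsPicardLindelof.of_time_independent (fun z hz => by rw [hL']; exact h.norm_le z hz u)
      (LipschitzOnWith.of_dist_le_mul fun z hz z' hz' => by
        rw [dist_eq_norm, dist_eq_norm, hL']; exact h.norm_sub_le z' hz' z hz u)
      (by simpa [hL'] using hL)
  -- The Picard fixed point is used directly because it also carries the confinement to the closed
  -- ball.
  obtain ⟨α, hα⟩ := ODE.FunSpace.exists_isFixedPt_next hpl (Metric.mem_closedBall_self (by simp))
  refine ⟨α.compProj, ?_, fun t ht => ?_, fun t _ =>
    α.compProj_mem_closedBall hpl.mul_max_le⟩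
  · have : α.compProj ((⟨0, by simp⟩ : Icc (0 : ℝ) 1) : ℝ) = x := by
      rw [ODE.FunSpace.compProj_val, ← hα, ODE.FunSpace.next_apply₀]
    exact this
  · exact (ODE.hasDerivWithinAt_picard_Icc (by simp : (0 : ℝ) ∈ Icc (0 : ℝ) 1)
      hpl.continuousOn_uncurry α.continuous_compProj.continuousOn
      (fun _ _ => α.compProj_mem_closedBall hpl.mul_max_le) x ht).congr_of_mem
      (fun s hs => by
        nth_rw 1 [← hα]
        rw [ODE.FunSpace.compProj_of_mem hs, ODE.FunSpace.next_apply]) ht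

theorem norm_trajectory_sub_le (h : LocalFrame Y w x ρ M) {u : ι → ℝ} {W : ℝ → E}
    (hW : IsTrajectory Y x ρ u W) {s : ℝ} (hs : s ∈ Icc (0 : ℝ) 1) : ‖W s - x‖ ≤ M * ‖u‖ := by
  have h1 := (convex_Icc (0 : ℝ) 1).norm_image_sub_le_of_norm_hasDerivWithin_le hW.deriv
    (fun s hs => h.norm_le _ (hW.mem s hs) u) (by simp : (0 : ℝ) ∈ Icc (0 : ℝ) 1) hs
  rw [hW.zero, sub_zero, Real.norm_of_nonneg hs.1] at h1
  have : 0 ≤ M * ‖u‖ := mul_nonneg h.pos.le (norm_nonneg _)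
  nlinarith [hs.2]

/-- The exponential map is a small perturbation of the linear map `comb Y x`. -/
theorem norm_trajectory_sub_trajectory_sub_le (h : LocalFrame Y w x ρ M) {u v : ι → ℝ}
    (hu : ‖u‖ ≤ expRadius ρ M) (hv : ‖v‖ ≤ expRadius ρ M) {U V : ℝ → E}
    (hU : IsTrajectory Y x ρ u U) (hV : IsTrajectory Y x ρ v V) {s : ℝ}
    (hs : s ∈ Icc (0 : ℝ) 1) :
    ‖U s - V s - s • comb Y x (u - v)‖ ≤ (2 * M)⁻¹ * ‖u - v‖ := by
  have hM := h.pos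
  have hx : x ∈ Metric.closedBall x ρ := Metric.mem_closedBall_self h.radius_pos.le
  have hη := h.expRadius_pos
  have key := norm_le_of_norm_deriv_le_add
    (f := fun s => U s - V s - s • comb Y x (u - v))
    (f' := fun s => comb Y (U s) u - comb Y (V s) v - (1 : ℝ) • comb Y x (u - v))
    (ε := 2 * M ^ 2 * expRadius ρ M * ‖u - v‖) (by simp [hU.zero, hV.zero]) (by positivity)
    (fun s hs => ((hU.deriv s hs).sub (hV.deriv s hs)).sub
      ((hasDerivWithinAt_id s _).smul_const _)) (fun s hs => by
      have e : comb Y (U s) u - comb Y (V s) v - (1 : ℝ) • comb Y x (u - v)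
          = (comb Y (U s) (u - v) - comb Y x (u - v)) + (comb Y (U s) v - comb Y (V s) v) := by
        simp only [map_sub, one_smul]; abel
      have h1 := h.norm_sub_le x hx (U s) (hU.mem s hs) (u - v)
      have h2 := h.norm_sub_le (V s) (hV.mem s hs) (U s) (hU.mem s hs) v
      have h3 : ‖U s - x‖ ≤ M * expRadius ρ M :=
        (h.norm_trajectory_sub_le hU hs).trans (by gcongr)
      have h4 : ‖U s - V s‖ ≤ ‖U s - V s - s • comb Y x (u - v)‖ + M * ‖u - v‖ := by
        have h5 : ‖s • comb Y x (u - v)‖ ≤ M * ‖u - v‖ := by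
          rw [norm_smul, Real.norm_of_nonneg hs.1]
          have := h.norm_le x hx (u - v)
          nlinarith [hs.2, hs.1, norm_nonneg (comb Y x (u - v))]
        calc ‖U s - V s‖ = ‖(U s - V s - s • comb Y x (u - v)) + s • comb Y x (u - v)‖ := by
              rw [sub_add_cancel]
          _ ≤ _ := (norm_add_le _ _).trans (by gcongr)
      rw [e]
      calc _ ≤ _ := norm_add_le _ _
        _ ≤ M * ‖u - v‖ * (M * expRadius ρ M) + M * expRadius ρ M *
            (‖U s - V s - s • comb Y x (u - v)‖ + M * ‖u - v‖) := by
          refine add_le_add (h1.trans (by gcongr)) (h2.trans ?_)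
          gcongr
        _ ≤ _ := by
          have := h.mul_expRadius_le_one
          nlinarith [norm_nonneg (U s - V s - s • comb Y x (u - v))]) s hs
  refine key.trans ?_
  -- Equivalent to `8 M³ · expRadius ≤ 1`, whence the second term in `expRadius`.
  have h6 : 2 * (2 * M ^ 2 * expRadius ρ M) ≤ (2 * M)⁻¹ := by
    rw [← one_div, le_div_iff₀ (by positivity)]
    have := h.cube_mul_expRadius_le
    nlinarith
  calc _ = 2 * (2 * M ^ 2 * expRadius ρ M) * ‖u - v‖ := by ring
    _ ≤ _ := by gcongr

theorem norm_trajectory_sub_trajectory_le (h : LocalFrame Y w x ρ M) {u v : ι → ℝ}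
    (hu : ‖u‖ ≤ expRadius ρ M) (hv : ‖v‖ ≤ expRadius ρ M) {U V : ℝ → E}
    (hU : IsTrajectory Y x ρ u U) (hV : IsTrajectory Y x ρ v V) {s : ℝ}
    (hs : s ∈ Icc (0 : ℝ) 1) : ‖U s - V s‖ ≤ 2 * M * ‖u - v‖ := by
  have hM := h.pos
  have hx : x ∈ Metric.closedBall x ρ := Metric.mem_closedBall_self h.radius_pos.le
  have h1 := h.norm_trajectory_sub_trajectory_sub_le hu hv hU hV hs
  have h2 : ‖s • comb Y x (u - v)‖ ≤ M * ‖u - v‖ := by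
    rw [norm_smul, Real.norm_of_nonneg hs.1]
    have := h.norm_le x hx (u - v)
    nlinarith [hs.2, hs.1, norm_nonneg (comb Y x (u - v))]
  have h3 : (2 * M)⁻¹ ≤ M := by
    rw [inv_le_iff_one_le_mul₀ (by positivity)]
    nlinarith [h.one_le]
  calc ‖U s - V s‖ = ‖(U s - V s - s • comb Y x (u - v)) + s • comb Y x (u - v)‖ := by
        rw [sub_add_cancel]
    _ ≤ (2 * M)⁻¹ * ‖u - v‖ + M * ‖u - v‖ := (norm_add_le _ _).trans (by gcongr)
    _ ≤ M * ‖u - v‖ + M * ‖u - v‖ := by gcongr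
    _ = _ := by ring

/-- The linear part expands by at least `1/M` and the perturbation has Lipschitz constant `1/(2M)`,
so half of the expansion survives. -/
theorem norm_sub_le_trajectory_one (h : LocalFrame Y w x ρ M) {u v : ι → ℝ}
    (hu : ‖u‖ ≤ expRadius ρ M) (hv : ‖v‖ ≤ expRadius ρ M) {U V : ℝ → E}
    (hU : IsTrajectory Y x ρ u U) (hV : IsTrajectory Y x ρ v V) :
    ‖u - v‖ ≤ 2 * M * ‖U 1 - V 1‖ := by
  have hM := h.pos
  have hx : x ∈ Metric.closedBall x ρ := Metric.mem_closedBall_self h.radius_pos.le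
  have h1 := h.norm_trajectory_sub_trajectory_sub_le hu hv hU hV (s := 1) (by simp)
  rw [one_smul] at h1
  have h2 := h.norm_le_comb x hx (u - v)
  have h3 : ‖comb Y x (u - v)‖ ≤ ‖U 1 - V 1‖ + (2 * M)⁻¹ * ‖u - v‖ := by
    calc ‖comb Y x (u - v)‖ = ‖(U 1 - V 1) - (U 1 - V 1 - comb Y x (u - v))‖ := by
          rw [sub_sub_cancel]
      _ ≤ _ := (_root_.norm_sub_le _ _).trans (by gcongr)
  have h4 : ‖u - v‖ ≤ M * ‖U 1 - V 1‖ + 2⁻¹ * ‖u - v‖ := by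
    calc ‖u - v‖ ≤ M * (‖U 1 - V 1‖ + (2 * M)⁻¹ * ‖u - v‖) := h2.trans (by gcongr)
      _ = _ := by field_simp
  linarith

/-- The exponential map covers a ball of radius comparable to that of its domain. -/
theorem exists_trajectory_one_eq [CompleteSpace E] (h : LocalFrame Y w x ρ M)
    {W : (ι → ℝ) → ℝ → E} (hW : ∀ u, ‖u‖ ≤ expRadius ρ M → IsTrajectory Y x ρ u (W u)) {y : E}
    (hy : ‖y - x‖ ≤ expRadius ρ M / (2 * M)) : ∃ u, ‖u‖ ≤ expRadius ρ M ∧ W u 1 = y := by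
  have hM := h.pos
  have hη := h.expRadius_pos
  have hx : x ∈ Metric.closedBall x ρ := Metric.mem_closedBall_self h.radius_pos.le
  obtain ⟨e, he⟩ := h.isInvertible x hx
  obtain ⟨c, hc⟩ : ∃ c : ℝ≥0, (c : ℝ) = (2 * M)⁻¹ := ⟨⟨(2 * M)⁻¹, by positivity⟩, rfl⟩
  obtain ⟨N, hN⟩ : ∃ N : ℝ≥0, (N : ℝ) = M := ⟨⟨M, hM.le⟩, rfl⟩
  have hal : ApproximatesLinearOn (fun u => W u 1) (comb Y x)
      (Metric.closedBall 0 (expRadius ρ M)) c := fun u hu v hv => by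
    rw [mem_closedBall_zero_iff] at hu hv
    rw [hc]
    simpa only [one_smul] using h.norm_trajectory_sub_trajectory_sub_le hu hv (hW u hu) (hW v hv)
      (s := 1)
      (by simp)
  let S : (comb Y x).NonlinearRightInverse :=
    { toFun := e.symm
      nnnorm := N
      bound' := fun y => by
        have := h.norm_le_comb x hx (e.symm y)
        rw [← he] at this
        simpa [hN] using this
      right_inv' := fun y => by rw [← he]; simp }
  -- The covered radius is `(1/M - 1/(2M)) · expRadius = expRadius / (2M)`.
  have hsurj := hal.surjOn_closedBall_of_nonlinearRightInverse S hη.le subset_rfl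
  have h0 : W 0 1 = x := by
    have := h.norm_trajectory_sub_le (hW 0 (by simpa using hη.le)) (s := 1) (by simp)
    simpa [sub_eq_zero] using this
  have hmem : y ∈ Metric.closedBall (W 0 1)
      (((S.nnnorm : ℝ)⁻¹ - (c : ℝ)) * expRadius ρ M) := by
    rw [h0, mem_closedBall_iff_norm]
    refine hy.trans (le_of_eq ?_)
    rw [show (S.nnnorm : ℝ) = M from hN, hc]
    field_simp
    ring
  obtain ⟨u, hu, hu1⟩ := hsurj hmem
  exact ⟨u, by simpa using hu, hu1⟩

end LocalFrame

end Frame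

/-! ### The anisotropic estimate and the lifting of curves -/

section Estimate

variable {ι : Type*} [Fintype ι] {E : Type*} [NormedAddCommGroup E] [NormedSpace ℝ E]
  {Y : ι → E → E} {w : ι → ℕ} {x : E} {ρ M : ℝ}

namespace LocalFrame

theorem hasFDerivAt_comb (h : LocalFrame Y w x ρ M) {z : E} (hz : z ∈ Metric.closedBall x ρ) :
    HasFDerivAt (comb Y) (fderiv ℝ (comb Y) z) z :=
  ((h.contDiffAt z hz).differentiableAt (by simp)).hasFDerivAt

/-- The coordinates, with respect to the frame along a trajectory, of a differentiable curve are
differentiable. -/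
theorem exists_hasDerivWithinAt_coordinates (h : LocalFrame Y w x ρ M) {u : ι → ℝ} {U : ℝ → E}
    (hU : IsTrajectory Y x ρ u U) {D : ℝ → E} {D' : E} {s : ℝ} (hs : s ∈ Icc (0 : ℝ) 1)
    (hD : HasDerivWithinAt D D' (Icc 0 1) s) :
    ∃ m', HasDerivWithinAt (fun s => (comb Y (U s)).inverse (D s)) m' (Icc 0 1) s ∧
      D' = fderiv ℝ (comb Y) (U s) (comb Y (U s) u) ((comb Y (U s)).inverse (D s))
        + comb Y (U s) m' := by
  have hcomb : ∀ s ∈ Icc (0 : ℝ) 1, HasDerivWithinAt (fun s => comb Y (U s))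
      (fderiv ℝ (comb Y) (U s) (comb Y (U s) u)) (Icc 0 1) s := fun s hs =>
    (h.hasFDerivAt_comb (hU.mem s hs)).comp_hasDerivWithinAt s (hU.deriv s hs)
  have hinv := (((h.isInvertible _ (hU.mem s hs)).contDiffAt_map_inverse
    (n := 1)).differentiableAt (by simp)).hasFDerivAt.comp_hasDerivWithinAt s (hcomb s hs)
  have hm := hinv.clm_apply hD
  refine ⟨_, hm, ?_⟩
  have hprod := (hcomb s hs).clm_apply hm
  -- Differentiating `comb Y (U s) (m s) = D s` by the product rule yields the formula for `D'`
  -- without computing the derivative of the inverse.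
  refine (uniqueDiffOn_Icc zero_lt_one s hs).eq_deriv _ hD (hprod.congr (fun t ht => ?_) ?_)
  · exact ((h.isInvertible _ (hU.mem t ht)).self_apply_inverse _).symm
  · exact ((h.isInvertible _ (hU.mem s hs)).self_apply_inverse _).symm

/-- What remains of `V' - U'` after linearisation is quadratic because `‖V - U‖ ≤ 2M‖v - u‖`; the
two terms contribute `2M²` and, using `M‖u‖ ≤ 1`, `4M²`. -/
theorem norm_error_le (h : LocalFrame Y w x ρ M) {u v : ι → ℝ} (hu : ‖u‖ ≤ expRadius ρ M)
    (hv : ‖v‖ ≤ expRadius ρ M) {U V : ℝ → E} (hU : IsTrajectory Y x ρ u U)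
    (hV : IsTrajectory Y x ρ v V) {s : ℝ} (hs : s ∈ Icc (0 : ℝ) 1) :
    ‖comb Y (V s) v - comb Y (U s) u - comb Y (U s) (v - u)
      - fderiv ℝ (comb Y) (U s) (V s - U s) u‖ ≤ 6 * M ^ 2 * ‖v - u‖ ^ 2 := by
  have hM := h.pos
  have hD := h.norm_trajectory_sub_trajectory_le hv hu hV hU hs
  have h1 := h.norm_sub_le _ (hU.mem s hs) _ (hV.mem s hs) (v - u)
  have h2 := h.taylor _ (hU.mem s hs) _ (hV.mem s hs) u
  have hMu : M * ‖u‖ ≤ 1 :=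
    (by gcongr : M * ‖u‖ ≤ M * expRadius ρ M).trans h.mul_expRadius_le_one
  have e : comb Y (V s) v - comb Y (U s) u - comb Y (U s) (v - u)
      - fderiv ℝ (comb Y) (U s) (V s - U s) u
      = (comb Y (V s) (v - u) - comb Y (U s) (v - u))
        + (comb Y (V s) u - comb Y (U s) u - fderiv ℝ (comb Y) (U s) (V s - U s) u) := by
    simp only [map_sub]; abel
  rw [e]
  calc _ ≤ _ := norm_add_le _ _
    _ ≤ M * ‖v - u‖ * (2 * M * ‖v - u‖) + 1 * (2 * M * ‖v - u‖) ^ 2 := by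
      refine add_le_add (h1.trans (by gcongr)) (h2.trans ?_)
      gcongr
    _ = _ := by ring

/-- The key estimate: the anisotropic size of an increment of the exponential coordinates is
controlled by that of the coordinates, in the frame, of the increment of the exponential map. -/
theorem norm_dilate_sub_le (h : LocalFrame Y w x ρ M) {R : ℝ} (hR : 0 < R) (hR1 : R ≤ 1)
    {u v : ι → ℝ} (hu : ‖u‖ ≤ expRadius ρ M) (hv : ‖v‖ ≤ expRadius ρ M) {U V : ℝ → E}
    (hU : IsTrajectory Y x ρ u U) (hV : IsTrajectory Y x ρ v V)
    (hdil : 4 * M * ‖dilate w R u‖ ≤ 1) :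
    ‖dilate w R (v - u)‖ ≤ 2 * ‖dilate w R ((comb Y (U 1)).inverse (V 1 - U 1))‖
      + 24 * M ^ 3 * ‖dilate w R‖ * ‖v - u‖ ^ 2 := by
  have hM := h.pos
  set m : ℝ → ι → ℝ := fun s => (comb Y (U s)).inverse (V s - U s) with hm
  have hex : ∀ s, ∃ m', s ∈ Icc (0 : ℝ) 1 → HasDerivWithinAt m m' (Icc 0 1) s ∧
      comb Y (V s) v - comb Y (U s) u
        = fderiv ℝ (comb Y) (U s) (comb Y (U s) u) (m s) + comb Y (U s) m' := fun s => by
    by_cases hs : s ∈ Icc (0 : ℝ) 1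
    · obtain ⟨m', h1, h2⟩ := h.exists_hasDerivWithinAt_coordinates hU hs
        ((hV.deriv s hs).sub (hU.deriv s hs))
      exact ⟨m', fun _ => ⟨h1, h2⟩⟩
    · exact ⟨0, fun hs' => absurd hs' hs⟩
  choose m' hm' using hex
  -- Here `m' = (v - u) - c + error`. The graded bound on `c` and `hdil` produce the factor `1/4`.
  -- The error is dilated crudely by the operator norm, whose dependence on `R` is harmless next to
  -- a quadratic term.
  have hbound : ∀ s ∈ Icc (0 : ℝ) 1, ‖dilate w R (m' s - (v - u))‖
      ≤ 4⁻¹ * ‖dilate w R (m s)‖ + 6 * M ^ 3 * ‖dilate w R‖ * ‖v - u‖ ^ 2 := by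
    intro s hs
    obtain ⟨c, hc, hcR⟩ := h.bracket _ (hU.mem s hs) u (m s)
    have hcm : comb Y (U s) (m s) = V s - U s :=
      (h.isInvertible _ (hU.mem s hs)).self_apply_inverse _
    have herr := h.norm_error_le hu hv hU hV hs
    have he : comb Y (U s) (m' s - (v - u) + c)
        = comb Y (V s) v - comb Y (U s) u - comb Y (U s) (v - u)
          - fderiv ℝ (comb Y) (U s) (V s - U s) u := by
      rw [map_add, map_sub _ (m' s), ← hc, (hm' s hs).2, hcm]
      abel
    have h1 : ‖m' s - (v - u) + c‖ ≤ 6 * M ^ 3 * ‖v - u‖ ^ 2 := by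
      calc _ ≤ M * ‖comb Y (U s) (m' s - (v - u) + c)‖ := h.norm_le_comb _ (hU.mem s hs) _
        _ ≤ M * (6 * M ^ 2 * ‖v - u‖ ^ 2) := by rw [he]; gcongr
        _ = _ := by ring
    calc ‖dilate w R (m' s - (v - u))‖
        = ‖dilate w R (m' s - (v - u) + c) - dilate w R c‖ := by
          rw [← map_sub, add_sub_cancel_right]
      _ ≤ ‖dilate w R‖ * ‖m' s - (v - u) + c‖ + M * ‖dilate w R u‖ * ‖dilate w R (m s)‖ :=
        (_root_.norm_sub_le _ _).trans
          (add_le_add ((dilate w R).le_opNorm _) (hcR R hR hR1))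
      _ ≤ ‖dilate w R‖ * (6 * M ^ 3 * ‖v - u‖ ^ 2) + 4⁻¹ * ‖dilate w R (m s)‖ := by
        gcongr
        linarith
      _ = _ := by ring
  set q := dilate w R (v - u) with hq
  -- Grönwall gives `‖dilate w R (m 1) - q‖ ≤ ‖q‖/2 + 12 M³ (⋯)`; absorbing `‖q‖/2` doubles the
  -- constants to 2 and 24.
  have hg := norm_le_of_norm_deriv_le_add
    (f := fun s => dilate w R (m s) - s • q) (f' := fun s => dilate w R (m' s) - (1 : ℝ) • q)
    (ε := 4⁻¹ * ‖q‖ + 6 * M ^ 3 * ‖dilate w R‖ * ‖v - u‖ ^ 2)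
    (by simp [hm, hU.zero, hV.zero]) (by positivity)
    (fun s hs => ((dilate w R).hasFDerivAt.comp_hasDerivWithinAt s (hm' s hs).1).sub
      ((hasDerivWithinAt_id s _).smul_const _)) (fun s hs => by
      have h1 := hbound s hs
      rw [map_sub (dilate w R) (m' s)] at h1
      rw [one_smul]
      have h2 : ‖dilate w R (m s)‖ ≤ ‖dilate w R (m s) - s • q‖ + ‖q‖ := by
        calc ‖dilate w R (m s)‖ = ‖(dilate w R (m s) - s • q) + s • q‖ := by rw [sub_add_cancel]
          _ ≤ _ := (norm_add_le _ _).trans (by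
            rw [norm_smul, Real.norm_of_nonneg hs.1]
            gcongr
            exact mul_le_of_le_one_left (norm_nonneg _) hs.2)
      have := norm_nonneg (dilate w R (m s) - s • q)
      linarith) 1 (by simp)
  rw [one_smul] at hg
  have h3 : ‖q‖ ≤ ‖dilate w R (m 1)‖ + ‖dilate w R (m 1) - q‖ := by
    calc ‖q‖ = ‖dilate w R (m 1) - (dilate w R (m 1) - q)‖ := by rw [sub_sub_cancel]
      _ ≤ _ := _root_.norm_sub_le _ _
  linarith

/-- A curve with small velocity with respect to the frame stays close to its initial point. -/
theorem norm_curve_sub_lt (h : LocalFrame Y w x ρ M) {φ : ℝ → E} {β r : ℝ}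
    (hφ : AbsolutelyContinuousOnInterval φ 0 1) (hφ0 : φ 0 = x) (hr : r ≤ ρ)
    (hβ0 : 0 ≤ β) (hβ : M * β < r)
    (hd : ∀ᵐ t ∂(volume.restrict (Icc (0 : ℝ) 1)), φ t ∈ Metric.closedBall x ρ →
      ∃ b, HasDerivAt φ (comb Y (φ t) b) t ∧ ‖b‖ ≤ β) :
    ∀ t ∈ Icc (0 : ℝ) 1, ‖φ t - x‖ < r := by
  have hM := h.pos
  have hcont := hφ.continuousOn
  rw [uIcc_of_le zero_le_one] at hcont
  refine lt_of_forall_le_imp_lt ((hcont.sub continuousOn_const).norm) fun T hT hle => ?_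
  have hac : AbsolutelyContinuousOnInterval φ 0 T := hφ.mono (by
    rw [uIcc_of_le hT.1, uIcc_of_le zero_le_one]
    exact Icc_subset_Icc_right hT.2)
  have hsub := AbsolutelyContinuousOnInterval.norm_sub_le (C := M * β) hT.1 hac (by
    have h1 := ae_mono (Measure.restrict_mono (Icc_subset_Icc_right hT.2) le_rfl) hd
    have h2 : ∀ᵐ t ∂(volume.restrict (Icc (0 : ℝ) T)), t ≠ T :=
      ae_restrict_of_ae (by simp [ae_iff])
    filter_upwards [h1, h2, ae_restrict_mem measurableSet_Icc] with t ht htT hmem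
    have hball : φ t ∈ Metric.closedBall x ρ := by
      rw [mem_closedBall_iff_norm]
      exact (hle t hmem (lt_of_le_of_ne hmem.2 htT)).trans hr
    obtain ⟨b, hb, hbβ⟩ := ht hball
    exact ⟨_, hb, (h.norm_le _ hball b).trans (by gcongr)⟩)
  rw [hφ0] at hsub
  have : M * β * T ≤ M * β := mul_le_of_le_one_right (by positivity) hT.2
  linarith

/-- Lifting a curve to exponential coordinates. -/
theorem exists_trajectory_one_eq_of_curve [CompleteSpace E] (h : LocalFrame Y w x ρ M) {R σ : ℝ}
    (hR : 0 < R) (hR1 : R ≤ 1) (hσ0 : 0 ≤ σ) (hσ : 8 * M * σ < 1) {W : (ι → ℝ) → ℝ → E}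
    (hW : ∀ u, ‖u‖ ≤ expRadius ρ M → IsTrajectory Y x ρ u (W u)) {φ : ℝ → E}
    (hφ : AbsolutelyContinuousOnInterval φ 0 1) (hφ0 : φ 0 = x)
    (hclose : ∀ t ∈ Icc (0 : ℝ) 1, ‖φ t - x‖ ≤ expRadius ρ M / (2 * M))
    (hd : ∀ᵐ t ∂(volume.restrict (Icc (0 : ℝ) 1)),
      ∃ b, HasDerivAt φ (comb Y (φ t) b) t ∧ ‖dilate w R b‖ ≤ σ) :
    ∃ u, ‖u‖ ≤ expRadius ρ M ∧ ‖dilate w R u‖ < (4 * M)⁻¹ ∧ W u 1 = φ 1 := by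
  have hM := h.pos
  have hη := h.expRadius_pos
  have hex : ∀ t, ∃ u, t ∈ Icc (0 : ℝ) 1 → ‖u‖ ≤ expRadius ρ M ∧ W u 1 = φ t := fun t => by
    by_cases ht : t ∈ Icc (0 : ℝ) 1
    · obtain ⟨u, hu⟩ := h.exists_trajectory_one_eq hW (hclose t ht)
      exact ⟨u, fun _ => hu⟩
    · exact ⟨0, fun ht' => absurd ht' ht⟩
  choose u hu using hex
  -- The lower Lipschitz bound for `exp` makes the pointwise chosen `u` inherit absolute continuity
  -- from `φ`.
  have hlip : ∀ s ∈ Icc (0 : ℝ) 1, ∀ t ∈ Icc (0 : ℝ) 1,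
      ‖u s - u t‖ ≤ 2 * M * ‖φ s - φ t‖ := fun s hs t ht => by
    have := h.norm_sub_le_trajectory_one (hu s hs).1 (hu t ht).1 (hW _ (hu s hs).1)
      (hW _ (hu t ht).1)
    rwa [(hu s hs).2, (hu t ht).2] at this
  have hI : uIcc (0 : ℝ) 1 = Icc 0 1 := uIcc_of_le zero_le_one
  have hu0 : u 0 = 0 := by
    have h1 := h.norm_sub_le_trajectory_one (hu 0 (by simp)).1 (v := 0) (by simpa using hη.le)
      (hW _ (hu 0 (by simp)).1) (hW 0 (by simpa using hη.le))
    have h2 := h.norm_trajectory_sub_le (hW 0 (by simpa using hη.le)) (s := 1) (by simp)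
    rw [norm_zero, mul_zero, norm_le_zero_iff, sub_eq_zero] at h2
    rw [(hu 0 (by simp)).2, h2, hφ0, sub_self, norm_zero, mul_zero, sub_zero,
      norm_le_zero_iff] at h1
    exact h1
  have hac : AbsolutelyContinuousOnInterval u 0 1 :=
    absolutelyContinuousOnInterval_of_dist_le (C := 2 * M) hφ fun s hs t ht => by
      rw [dist_eq_norm, dist_eq_norm]
      exact hlip s (hI ▸ hs) t (hI ▸ ht)
  have hacd : AbsolutelyContinuousOnInterval (fun t => dilate w R (u t)) 0 1 :=
    absolutelyContinuousOnInterval_of_dist_le (C := ‖dilate w R‖) hac fun s _ t _ => by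
      rw [dist_eq_norm, dist_eq_norm, ← map_sub]
      exact (dilate w R).le_opNorm _
  have hdiff : ∀ᵐ t ∂(volume.restrict (Icc (0 : ℝ) 1)), DifferentiableAt ℝ u t := by
    have hcoord : ∀ i, ∀ᵐ t, t ∈ uIcc (0 : ℝ) 1 → DifferentiableAt ℝ (fun t => u t i) t :=
      fun i => AbsolutelyContinuousOnInterval.ae_differentiableAt
        (absolutelyContinuousOnInterval_of_dist_le (C := 1) hac fun s _ t _ => by
          rw [one_mul]; exact dist_le_pi_dist (u s) (u t) i)
    rw [ae_restrict_iff' measurableSet_Icc]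
    filter_upwards [ae_all_iff.2 hcoord] with t ht hmem
    exact differentiableAt_pi.2 fun i => ht i (hI ▸ hmem)
  have hderiv : ∀ᵐ t ∂(volume.restrict (Icc (0 : ℝ) 1)), 4 * M * ‖dilate w R (u t)‖ ≤ 1 →
      ∃ v, HasDerivAt (fun t => dilate w R (u t)) v t ∧ ‖v‖ ≤ 2 * σ := by
    have hne : ∀ a : ℝ, ∀ᵐ t ∂(volume.restrict (Icc (0 : ℝ) 1)), t ≠ a := fun a =>
      ae_restrict_of_ae (by simp [ae_iff])
    filter_upwards [hd, hdiff, hne 0, hne 1, ae_restrict_mem measurableSet_Icc]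
      with t ⟨b, hb, hbσ⟩ hut ht0 ht1 hmem hsmall
    have hnhds : Icc (0 : ℝ) 1 ∈ 𝓝 t :=
      Icc_mem_nhds (lt_of_le_of_ne hmem.1 (Ne.symm ht0)) (lt_of_le_of_ne hmem.2 ht1)
    have hball : φ t ∈ Metric.closedBall x ρ := by
      rw [← (hu t hmem).2]
      exact (hW _ (hu t hmem).1).mem 1 (by simp)
    have hDu := (dilate w R).hasFDerivAt.comp_hasDerivAt t hut.hasDerivAt
    refine ⟨_, hDu, ?_⟩
    set θ := (comb Y (φ t)).inverse with hθ
    -- Divide the key estimate by `|t' - t|`. The quadratic error tends to zero as `t' → t` at fixed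
    -- `R`, leaving `‖dilate w R u'‖ ≤ 2 ‖dilate w R b‖`.
    have hineq : ∀ᶠ t' in 𝓝[≠] t, ‖slope (fun t => dilate w R (u t)) t t'‖
        ≤ 2 * ‖dilate w R (θ (slope φ t t'))‖
          + 24 * M ^ 3 * ‖dilate w R‖ * (‖slope u t t'‖ * ‖u t' - u t‖) := by
      filter_upwards [mem_nhdsWithin_of_mem_nhds hnhds] with t' ht'
      have h1 := h.norm_dilate_sub_le hR hR1 (hu t hmem).1 (hu t' ht').1 (hW _ (hu t hmem).1)
        (hW _ (hu t' ht').1) hsmall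
      rw [(hu t hmem).2, (hu t' ht').2, ← hθ] at h1
      simp only [slope_def_module, map_smul, norm_smul, ← map_sub (dilate w R)]
      calc ‖(t' - t)⁻¹‖ * ‖dilate w R (u t' - u t)‖
          ≤ ‖(t' - t)⁻¹‖ * (2 * ‖dilate w R (θ (φ t' - φ t))‖
            + 24 * M ^ 3 * ‖dilate w R‖ * ‖u t' - u t‖ ^ 2) := by gcongr
        _ = _ := by ring
    have hlim1 : Tendsto (fun t' => ‖slope (fun t => dilate w R (u t)) t t'‖) (𝓝[≠] t)
        (𝓝 ‖dilate w R (deriv u t)‖) := hDu.tendsto_slope.norm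
    have hlim2 : Tendsto (fun t' => 2 * ‖dilate w R (θ (slope φ t t'))‖
          + 24 * M ^ 3 * ‖dilate w R‖ * (‖slope u t t'‖ * ‖u t' - u t‖)) (𝓝[≠] t)
        (𝓝 (2 * ‖dilate w R (θ (comb Y (φ t) b))‖
          + 24 * M ^ 3 * ‖dilate w R‖ * (‖deriv u t‖ * ‖u t - u t‖))) := by
      have hc1 : Tendsto (fun t' => dilate w R (θ (slope φ t t'))) (𝓝[≠] t)
          (𝓝 (dilate w R (θ (comb Y (φ t) b)))) :=
        (((dilate w R).continuous.comp θ.continuous).tendsto _).comp hb.tendsto_slope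
      have hc2 : Tendsto (fun t' => u t' - u t) (𝓝[≠] t) (𝓝 (u t - u t)) :=
        (hut.continuousAt.tendsto.mono_left nhdsWithin_le_nhds).sub tendsto_const_nhds
      exact (hc1.norm.const_mul 2).add
        ((hut.hasDerivAt.tendsto_slope.norm.mul hc2.norm).const_mul _)
    have hfin := le_of_tendsto_of_tendsto hlim1 hlim2 hineq
    have hθb : θ (comb Y (φ t) b) = b := (h.isInvertible _ hball).inverse_apply_self b
    rw [hθb, sub_self, norm_zero, mul_zero, mul_zero, add_zero] at hfin
    exact hfin.trans (by gcongr)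
  have hcont := hacd.continuousOn
  rw [hI] at hcont
  -- The derivative bound requires `‖dilate w R u‖ ≤ 1/(4M)`; integrating it returns the stricter
  -- `2σ < 1/(4M)`, so the induction closes.
  have hlt := lt_of_forall_le_imp_lt (ρ := (4 * M)⁻¹) hcont.norm (fun T hT hle => by
    have hacT : AbsolutelyContinuousOnInterval (fun t => dilate w R (u t)) 0 T :=
      hacd.mono (by rw [uIcc_of_le hT.1, hI]; exact Icc_subset_Icc_right hT.2)
    have hsub := AbsolutelyContinuousOnInterval.norm_sub_le (C := 2 * σ) hT.1 hacT (by
      have h1 := ae_mono (Measure.restrict_mono (Icc_subset_Icc_right hT.2) le_rfl) hderiv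
      have h2 : ∀ᵐ t ∂(volume.restrict (Icc (0 : ℝ) T)), t ≠ T :=
        ae_restrict_of_ae (by simp [ae_iff])
      filter_upwards [h1, h2, ae_restrict_mem measurableSet_Icc] with t ht htT hmem
      refine ht ?_
      have := hle t hmem (lt_of_le_of_ne hmem.2 htT)
      rw [← one_div, le_div_iff₀ (by positivity)] at this
      linarith)
    rw [hu0, map_zero, sub_zero] at hsub
    have h3 : 2 * σ * T ≤ 2 * σ := mul_le_of_le_one_right (by positivity) hT.2
    have h4 : 2 * σ < (4 * M)⁻¹ := by
      rw [← one_div, lt_div_iff₀ (by positivity)]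
      linarith
    linarith) 1 (by simp)
  exact ⟨u 1, (hu 1 (by simp)).1, hlt, (hu 1 (by simp)).2⟩

end LocalFrame

end Estimate

/-! ### Uniform frame bounds on compact sets -/

section Existence

variable {ι : Type*} [Fintype ι] {E : Type*} [NormedAddCommGroup E] [NormedSpace ℝ E]
  {Y : ι → E → E} {w : ι → ℕ} {Ω : Set E}

theorem contDiffOn_comb (hY : ∀ i, ContDiffOn ℝ ∞ (Y i) Ω) : ContDiffOn ℝ ∞ (comb Y) Ω := by
  unfold comb
  exact ContDiffOn.sum fun i _ => contDiffOn_const.smulRight (hY i)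

theorem exists_nonneg_bound {A F : Type*} [TopologicalSpace A] [NormedAddCommGroup F] {K : Set A}
    (hK : IsCompact K)
    {f : A → F} (hf : ContinuousOn f K) : ∃ C, 0 ≤ C ∧ ∀ z ∈ K, ‖f z‖ ≤ C := by
  obtain ⟨C, hC⟩ := hK.exists_bound_of_continuousOn hf
  exact ⟨|C|, abs_nonneg C, fun z hz => (hC z hz).trans (le_abs_self C)⟩

/-- The constant is fixed before the convex set `s`, so one `C` serves all the balls around points
of a compact set that is not itself convex. -/
theorem exists_taylor_bound {F : Type*} [NormedAddCommGroup F] [NormedSpace ℝ F] (hΩ : IsOpen Ω)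
    {f : E → F} (hf : ContDiffOn ℝ ∞ f Ω) {K : Set E} (hK : IsCompact K) (hKΩ : K ⊆ Ω) :
    ∃ C, 0 ≤ C ∧ ∀ s ⊆ K, Convex ℝ s → ∀ z ∈ s, ∀ z' ∈ s,
      ‖f z' - f z - fderiv ℝ f z (z' - z)‖ ≤ C * ‖z' - z‖ ^ 2 := by
  have hf1 : ContDiffOn ℝ ∞ (fderiv ℝ f) Ω := hf.fderiv_of_isOpen hΩ (by simp)
  have hf2 : ContDiffOn ℝ ∞ (fderiv ℝ (fderiv ℝ f)) Ω := hf1.fderiv_of_isOpen hΩ (by simp)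
  obtain ⟨C, hC, hb⟩ := exists_nonneg_bound hK (hf2.continuousOn.mono hKΩ)
  refine ⟨C, hC, fun s hs hconv z hz z' hz' => ?_⟩
  have hseg : segment ℝ z z' ⊆ s := hconv.segment_subset hz hz'
  have hd1 : ∀ y ∈ s, DifferentiableAt ℝ (fderiv ℝ f) y := fun y hy =>
    (hf1.contDiffAt (hΩ.mem_nhds (hKΩ (hs hy)))).differentiableAt (by simp)
  have hDlip : ∀ y ∈ segment ℝ z z', ‖fderiv ℝ f y - fderiv ℝ f z‖ ≤ C * ‖z' - z‖ := fun y hy => by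
    refine (hconv.norm_image_sub_le_of_norm_fderiv_le hd1 (fun y hy => hb y (hs hy)) hz
      (hseg hy)).trans ?_
    gcongr
    exact norm_sub_le_of_mem_segment hy
  have h1 := (convex_segment z z').norm_image_sub_le_of_norm_fderiv_le' (fun y hy =>
    (hf.contDiffAt (hΩ.mem_nhds (hKΩ (hs (hseg hy))))).differentiableAt (by simp)) hDlip
    (left_mem_segment ℝ z z') (right_mem_segment ℝ z z')
  exact h1.trans_eq (by ring)

theorem fderiv_comb_apply (hΩ : IsOpen Ω) (hY : ∀ i, ContDiffOn ℝ ∞ (Y i) Ω) {z : E}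
    (hz : z ∈ Ω) (v : E) (m : ι → ℝ) :
    fderiv ℝ (comb Y) z v m = ∑ k, m k • fderiv ℝ (Y k) z v := by
  have hd : ∀ i, DifferentiableAt ℝ (Y i) z := fun i =>
    ((hY i).contDiffAt (hΩ.mem_nhds hz)).differentiableAt (by simp)
  have h1 : HasFDerivAt (comb Y) (fderiv ℝ (comb Y) z) z :=
    (((contDiffOn_comb hY).contDiffAt (hΩ.mem_nhds hz)).differentiableAt (by simp)).hasFDerivAt
  have h2 := h1.clm_apply (hasFDerivAt_const m z)
  have h3 : HasFDerivAt (fun z => comb Y z m) (∑ k, m k • fderiv ℝ (Y k) z) z := by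
    simp only [comb_apply]
    exact HasFDerivAt.fun_sum fun k _ => (hd k).hasFDerivAt.const_smul (m k)
  have h4 := congrArg (fun L : E →L[ℝ] E => L v) (h2.unique h3)
  simpa using h4

theorem abs_le_norm_dilate_mul {R : ℝ} (hR : 0 < R) (u : ι → ℝ) (i : ι) :
    |u i| ≤ ‖dilate w R u‖ * R ^ w i := by
  have h := norm_le_pi_norm (dilate w R u) i
  rw [dilate_apply, norm_div, Real.norm_eq_abs, Real.norm_of_nonneg (by positivity),
    div_le_iff₀ (by positivity)] at h
  exact h

theorem norm_dilate_le_of_abs_le {R C : ℝ} (hR : 0 < R) (hC : 0 ≤ C) {u : ι → ℝ}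
    (h : ∀ i, |u i| ≤ C * R ^ w i) : ‖dilate w R u‖ ≤ C := by
  refine (pi_norm_le_iff_of_nonneg hC).2 fun i => ?_
  rw [dilate_apply, norm_div, Real.norm_eq_abs, Real.norm_of_nonneg (by positivity),
    div_le_iff₀ (by positivity)]
  exact h i

/-- This is where the grading pays off: a nonzero `c i k l` has `w l ≤ w i + w k`, hence `R ^ (w i +
w k) ≤ R ^ w l` for `R ≤ 1`. -/
theorem norm_dilate_sum_le {R C : ℝ} (hR : 0 < R) (hR1 : R ≤ 1) (hC : 0 ≤ C) (u m : ι → ℝ)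
    {c : ι → ι → ι → ℝ} (hc : ∀ i k l, |c i k l| ≤ C)
    (hc0 : ∀ i k l, w i + w k < w l → c i k l = 0) :
    ‖dilate w R (∑ i, ∑ k, (u i * m k) • c i k)‖
      ≤ (Fintype.card ι) ^ 2 * C * ‖dilate w R u‖ * ‖dilate w R m‖ := by
  refine norm_dilate_le_of_abs_le hR (by positivity) fun l => ?_
  have hterm : ∀ i k, |u i * m k * c i k l|
      ≤ C * ‖dilate w R u‖ * ‖dilate w R m‖ * R ^ w l := by
    intro i k
    by_cases hw : w i + w k < w l
    · rw [hc0 i k l hw, mul_zero, abs_zero]; positivity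
    · rw [abs_mul, abs_mul]
      calc |u i| * |m k| * |c i k l|
          ≤ (‖dilate w R u‖ * R ^ w i) * (‖dilate w R m‖ * R ^ w k) * C := by
            gcongr
            · exact abs_le_norm_dilate_mul hR u i
            · exact abs_le_norm_dilate_mul hR m k
            · exact hc i k l
        _ = C * ‖dilate w R u‖ * ‖dilate w R m‖ * R ^ (w i + w k) := by ring
        _ ≤ _ := by
          gcongr 1
          exact pow_le_pow_of_le_one hR.le hR1 (not_lt.1 hw)
  calc |(∑ i, ∑ k, (u i * m k) • c i k) l| = |∑ i, ∑ k, u i * m k * c i k l| := by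
        simp [Finset.sum_apply]
    _ ≤ ∑ i, ∑ k, |u i * m k * c i k l| :=
      (Finset.abs_sum_le_sum_abs _ _).trans
        (Finset.sum_le_sum fun i _ => Finset.abs_sum_le_sum_abs _ _)
    _ ≤ ∑ _i : ι, ∑ _k : ι, C * ‖dilate w R u‖ * ‖dilate w R m‖ * R ^ w l :=
      Finset.sum_le_sum fun i _ => Finset.sum_le_sum fun k _ => hterm i k
    _ = _ := by simp; ring

theorem fderiv_comb_sub_eq (hΩ : IsOpen Ω) (hY : ∀ i, ContDiffOn ℝ ∞ (Y i) Ω) {z : E}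
    (hz : z ∈ Ω) (u m : ι → ℝ) {c : ι → ι → ι → ℝ}
    (hc : ∀ i k, VectorField.lieBracket ℝ (Y i) (Y k) z = comb Y z (c i k)) :
    fderiv ℝ (comb Y) z (comb Y z u) m - fderiv ℝ (comb Y) z (comb Y z m) u
      = comb Y z (∑ i, ∑ k, (u i * m k) • c i k) := by
  have h1 : fderiv ℝ (comb Y) z (comb Y z u) m
      = ∑ i, ∑ k, (u i * m k) • fderiv ℝ (Y k) z (Y i z) := by
    rw [fderiv_comb_apply hΩ hY hz, Finset.sum_comm]
    refine Finset.sum_congr rfl fun k _ => ?_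
    rw [comb_apply, map_sum, Finset.smul_sum]
    refine Finset.sum_congr rfl fun i _ => ?_
    rw [map_smul, smul_smul, mul_comm]
  have h2 : fderiv ℝ (comb Y) z (comb Y z m) u
      = ∑ i, ∑ k, (u i * m k) • fderiv ℝ (Y i) z (Y k z) := by
    rw [fderiv_comb_apply hΩ hY hz]
    refine Finset.sum_congr rfl fun k _ => ?_
    rw [comb_apply, map_sum, Finset.smul_sum]
    refine Finset.sum_congr rfl fun i _ => ?_
    rw [map_smul, smul_smul]
  rw [h1, h2, ← Finset.sum_sub_distrib, map_sum]
  refine Finset.sum_congr rfl fun i _ => ?_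
  rw [← Finset.sum_sub_distrib, map_sum]
  refine Finset.sum_congr rfl fun k _ => ?_
  rw [← smul_sub, map_smul, ← hc]
  rfl

/-- A frame of smooth vector fields with graded commutators is uniformly controlled near compact
sets. -/
theorem exists_localFrame [ProperSpace E] (hΩ : IsOpen Ω) (hY : ∀ i, ContDiffOn ℝ ∞ (Y i) Ω)
    (hinv : ∀ z ∈ Ω, (comb Y z).IsInvertible)
    (hbr : ∀ z ∈ Ω, ∀ i k, ∃ c : ι → ℝ, VectorField.lieBracket ℝ (Y i) (Y k) z = comb Y z c ∧
      ∀ l, w i + w k < w l → c l = 0)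
    {K : Set E} (hK : IsCompact K) (hKΩ : K ⊆ Ω) :
    ∃ ρ M, IsCompact (Metric.cthickening ρ K) ∧ Metric.cthickening ρ K ⊆ Ω ∧ 1 ≤ M ∧ 0 < ρ ∧
      ∀ x ∈ K, LocalFrame Y w x ρ M := by
  classical
  obtain ⟨ρ, hρ, hρΩ⟩ := hK.exists_cthickening_subset_open hΩ hKΩ
  have hKc : IsCompact (Metric.cthickening ρ K) := hK.cthickening
  have hF := contDiffOn_comb hY
  have hF1 : ContDiffOn ℝ ∞ (fderiv ℝ (comb Y)) Ω := hF.fderiv_of_isOpen hΩ (by simp)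
  have hFi : ContinuousOn (fun z => (comb Y z).inverse) Ω := fun z hz =>
    (((hinv z hz).contDiffAt_map_inverse (n := 1)).continuousAt.comp
      (hF.continuousOn.continuousAt (hΩ.mem_nhds hz))).continuousWithinAt
  obtain ⟨M₀, hM₀, hb₀⟩ := exists_nonneg_bound hKc (hF.continuousOn.mono hρΩ)
  obtain ⟨M₁, hM₁, hb₁⟩ := exists_nonneg_bound hKc (hF1.continuousOn.mono hρΩ)
  obtain ⟨M₂, hM₂, hb₂⟩ := exists_taylor_bound hΩ hF hKc hρΩ
  obtain ⟨M₃, hM₃, hb₃⟩ := exists_nonneg_bound hKc (hFi.mono hρΩ)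
  set M₄ : ℝ := M₃ * (2 * M₁ * M₀) with hM₄
  have hM₄0 : 0 ≤ M₄ := by positivity
  set M : ℝ := 1 + M₀ + M₁ + M₂ + M₃ + (Fintype.card ι) ^ 2 * M₄ with hM
  have hcard : 0 ≤ ((Fintype.card ι : ℝ)) ^ 2 * M₄ := by positivity
  refine ⟨ρ, M, hKc, hρΩ, by linarith, hρ, fun x hx => ?_⟩
  have hball : Metric.closedBall x ρ ⊆ Metric.cthickening ρ K :=
    Metric.closedBall_subset_cthickening hx ρ
  have hballΩ := hball.trans hρΩ
  have hd : ∀ z ∈ Metric.closedBall x ρ, DifferentiableAt ℝ (comb Y) z := fun z hz =>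
    (hF.contDiffAt (hΩ.mem_nhds (hballΩ hz))).differentiableAt (by simp)
  have hleft : ∀ z ∈ Metric.closedBall x ρ, ∀ u, ‖u‖ ≤ M₃ * ‖comb Y z u‖ := fun z hz u => by
    calc ‖u‖ = ‖(comb Y z).inverse (comb Y z u)‖ := by
          rw [(hinv z (hballΩ hz)).inverse_apply_self]
      _ ≤ _ := ((comb Y z).inverse.le_opNorm _).trans (by gcongr; exact hb₃ z (hball hz))
  refine ⟨by linarith, hρ, fun z hz => ?_, fun z hz => hinv z (hballΩ hz), fun z hz u => ?_,
    fun z hz u => ?_, fun z hz z' hz' u => ?_, fun z hz z' hz' u => ?_, fun z hz u m => ?_⟩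
  · exact (hF.contDiffAt (hΩ.mem_nhds (hballΩ hz))).of_le (by simp)
  · refine ((comb Y z).le_opNorm u).trans ?_
    gcongr
    linarith [hb₀ z (hball hz)]
  · refine (hleft z hz u).trans ?_
    gcongr
    linarith
  · have h1 := (convex_closedBall x ρ).norm_image_sub_le_of_norm_fderiv_le hd
      (fun y hy => hb₁ y (hball hy)) hz hz'
    calc ‖comb Y z' u - comb Y z u‖ = ‖(comb Y z' - comb Y z) u‖ := rfl
      _ ≤ ‖comb Y z' - comb Y z‖ * ‖u‖ := ContinuousLinearMap.le_opNorm _ _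
      _ ≤ M₁ * ‖z' - z‖ * ‖u‖ := by gcongr
      _ = M₁ * ‖u‖ * ‖z' - z‖ := by ring
      _ ≤ _ := by gcongr; linarith
  · have h1 := hb₂ _ hball (convex_closedBall x ρ) z hz z' hz'
    calc _ = ‖(comb Y z' - comb Y z - fderiv ℝ (comb Y) z (z' - z)) u‖ := rfl
      _ ≤ ‖comb Y z' - comb Y z - fderiv ℝ (comb Y) z (z' - z)‖ * ‖u‖ :=
        ContinuousLinearMap.le_opNorm _ _
      _ ≤ M₂ * ‖z' - z‖ ^ 2 * ‖u‖ := by gcongr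
      _ = M₂ * ‖u‖ * ‖z' - z‖ ^ 2 := by ring
      _ ≤ _ := by gcongr; linarith
  · choose c hc hc0 using hbr z (hballΩ hz)
    refine ⟨_, fderiv_comb_sub_eq hΩ hY (hballΩ hz) u m hc, fun R hR hR1 => ?_⟩
    -- The coefficients are chosen point by point, with no continuity in `z`; their bound comes from
    -- applying the inverse frame, of norm at most `M₃`, to the commutator.
    have hcle : ∀ i k l, |c i k l| ≤ M₄ := by
      intro i k l
      have hsingle : ∀ i, comb Y z (Pi.single i 1) = Y i z := fun i => by
        simp [comb_apply, Pi.single_apply]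
      have hYle : ∀ i, ‖Y i z‖ ≤ M₀ := fun i => by
        rw [← hsingle]
        refine ((comb Y z).le_opNorm _).trans ?_
        rw [Pi.norm_single, norm_one, mul_one]
        exact hb₀ z (hball hz)
      have hDle : ∀ i v, ‖fderiv ℝ (Y i) z v‖ ≤ M₁ * ‖v‖ := fun i v => by
        have e : fderiv ℝ (Y i) z v = fderiv ℝ (comb Y) z v (Pi.single i 1) := by
          rw [fderiv_comb_apply hΩ hY (hballΩ hz)]
          simp [Pi.single_apply]
        rw [e]
        refine ((fderiv ℝ (comb Y) z v).le_opNorm _).trans ?_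
        rw [Pi.norm_single, norm_one, mul_one]
        exact ((fderiv ℝ (comb Y) z).le_opNorm v).trans (by gcongr; exact hb₁ z (hball hz))
      calc |c i k l| ≤ ‖c i k‖ := norm_le_pi_norm (c i k) l
        _ ≤ M₃ * ‖comb Y z (c i k)‖ := hleft z hz _
        _ = M₃ * ‖fderiv ℝ (Y k) z (Y i z) - fderiv ℝ (Y i) z (Y k z)‖ := by rw [← hc]; rfl
        _ ≤ M₃ * (M₁ * M₀ + M₁ * M₀) := by
          gcongr
          exact (norm_sub_le _ _).trans (add_le_add
            ((hDle k _).trans (by gcongr; exact hYle i))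
            ((hDle i _).trans (by gcongr; exact hYle k)))
        _ = M₄ := by rw [hM₄]; ring
    refine (norm_dilate_sum_le hR hR1 hM₄0 u m hcle hc0).trans ?_
    gcongr
    linarith

end Existence

/-! ### Comparison of boxes and subelliptic balls -/

section Assembly

variable {E : Type*} [NormedAddCommGroup E] [NormedSpace ℝ E] {n : ℕ} {Ω : Set E}
  {X : Fin (n + 1) → E → E} {B : Finset (MultiIndex n)} {x : E} {ρ M : ℝ}

/-- The frame of the brackets `X_[I]`, `I ∈ B`. -/
noncomputable def bracketFrame (X : Fin (n + 1) → E → E) (B : Finset (MultiIndex n)) :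
    B → E → E := fun I => bracket X I

/-- The weights of the multiindices in `B`. -/
def frameWeight (B : Finset (MultiIndex n)) : B → ℕ := fun I => weight I.1

theorem comb_bracketFrame (X : Fin (n + 1) → E → E) (B : Finset (MultiIndex n)) (z : E)
    (u : MultiIndex n → ℝ) :
    comb (bracketFrame X B) z (fun I => u I) = ∑ I ∈ B, u I • bracket X I z := by
  rw [comb_apply, ← Finset.sum_coe_sort B]
  rfl

open Classical in
/-- Extension by zero of coefficients indexed by `B`. -/
noncomputable def extendCoeff (u : B → ℝ) : MultiIndex n → ℝ :=
  fun I => if h : I ∈ B then u ⟨I, h⟩ else 0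

theorem extendCoeff_coe (u : B → ℝ) (I : B) : extendCoeff u I = u I := by
  simp [extendCoeff]

theorem sum_extendCoeff_smul (u : B → ℝ) (z : E) :
    ∑ I ∈ B, extendCoeff u I • bracket X I z = comb (bracketFrame X B) z u := by
  rw [← comb_bracketFrame]
  congr 1
  exact funext fun I => extendCoeff_coe u I

theorem isInvertible_comb_bracketFrame (hbasis : IsBracketBasisAt X B x) :
    (comb (bracketFrame X B) x).IsInvertible := by
  have hfin : FiniteDimensional ℝ E :=
    (Module.Basis.mk hbasis.1 hbasis.2.ge).finiteDimensional_of_finite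
  refine ⟨(Module.Basis.mk hbasis.1 hbasis.2.ge).equivFun.symm.toContinuousLinearEquiv, ?_⟩
  ext u
  simp [comb_apply, bracketFrame, Module.Basis.equivFun_symm_apply]

theorem card_eq_finrank (hbasis : IsBracketBasisAt X B x) :
    Fintype.card B = Module.finrank ℝ E :=
  (Module.finrank_eq_card_basis (Module.Basis.mk hbasis.1 hbasis.2.ge)).symm

theorem weight_pos {I : MultiIndex n} (hI : I ≠ []) : 1 ≤ weight I :=
  (List.length_pos_iff.2 hI).trans_le (length_le_weight I)

theorem absolutelyContinuousOnInterval_of_isIntegralCurveOn {Y : E → E} (hY : ContinuousOn Y Ω)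
    {φ : ℝ → E} (hmem : ∀ t ∈ Icc (0 : ℝ) 1, φ t ∈ Ω)
    (hφ : IsIntegralCurveOn φ (fun _ => Y) (Icc 0 1)) :
    AbsolutelyContinuousOnInterval φ 0 1 := by
  have hcont : ContinuousOn φ (Icc 0 1) := fun t ht => (hφ t ht).continuousWithinAt
  obtain ⟨C, hC, hb⟩ := exists_nonneg_bound isCompact_Icc (hY.comp hcont hmem)
  obtain ⟨K, rfl⟩ : ∃ K : ℝ≥0, (K : ℝ) = C := ⟨⟨C, hC⟩, rfl⟩
  refine LipschitzOnWith.absolutelyContinuousOnInterval (K := K) ?_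
  rw [uIcc_of_le zero_le_one]
  exact (convex_Icc 0 1).lipschitzOnWith_of_nnnorm_hasDerivWithin_le hφ fun t ht => hb t ht

theorem ae_hasDerivAt_of_isIntegralCurveOn {Y : E → E} {φ : ℝ → E}
    (hφ : IsIntegralCurveOn φ (fun _ => Y) (Icc 0 1)) :
    ∀ᵐ t ∂(volume.restrict (Icc (0 : ℝ) 1)), HasDerivAt φ (Y (φ t)) t := by
  have hne : ∀ a : ℝ, ∀ᵐ t ∂(volume.restrict (Icc (0 : ℝ) 1)), t ≠ a := fun a =>
    ae_restrict_of_ae (by simp [ae_iff])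
  filter_upwards [hne 0, hne 1, ae_restrict_mem measurableSet_Icc] with t ht0 ht1 hmem
  exact (hφ t hmem).hasDerivAt
    (Icc_mem_nhds (lt_of_le_of_ne hmem.1 (Ne.symm ht0)) (lt_of_le_of_ne hmem.2 ht1))

theorem continuousOn_sum_bracket (hΩ : IsOpen Ω) (hX : ∀ i, ContDiffOn ℝ ∞ (X i) Ω)
    (u : MultiIndex n → ℝ) : ContinuousOn (fun z => ∑ I ∈ B, u I • bracket X I z) Ω :=
  continuousOn_finsetSum _ fun I _ => (contDiffOn_bracket hΩ hX I).continuousOn.const_smul (u I)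

theorem isExp_of_isTrajectory (hball : Metric.closedBall x ρ ⊆ Ω) {u : B → ℝ} {W : ℝ → E}
    (hW : IsTrajectory (bracketFrame X B) x ρ u W) :
    IsExp Ω (fun z => ∑ I ∈ B, extendCoeff u I • bracket X I z) x (W 1) := by
  refine ⟨W, hW.zero, rfl, fun t ht => hball (hW.mem t ht), fun t ht => ?_⟩
  have := hW.deriv t ht
  rwa [← sum_extendCoeff_smul] at this

/-- The exponential is unique: every solution coincides with the controlled trajectory. -/
theorem eq_trajectory_one_of_isExp (hΩ : IsOpen Ω) (hX : ∀ i, ContDiffOn ℝ ∞ (X i) Ω)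
    (h : LocalFrame (bracketFrame X B) (frameWeight B) x ρ M) {u : MultiIndex n → ℝ} {y : E}
    (hu : ‖fun I : B => u I‖ ≤ expRadius ρ M) (huρ : M * ‖fun I : B => u I‖ < ρ)
    (hy : IsExp Ω (fun z => ∑ I ∈ B, u I • bracket X I z) x y) {W : ℝ → E}
    (hW : IsTrajectory (bracketFrame X B) x ρ (fun I => u I) W) : y = W 1 := by
  obtain ⟨φ, hφ0, rfl, hmem, hφ⟩ := hy
  -- A solution is only assumed to stay in `Ω`; its speed, below `ρ` as long as it is in the ball,
  -- confines it to the ball where uniqueness applies.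
  have hlt := h.norm_curve_sub_lt
    (absolutelyContinuousOnInterval_of_isIntegralCurveOn (continuousOn_sum_bracket hΩ hX u) hmem hφ)
    hφ0 le_rfl (norm_nonneg _) huρ (by
      filter_upwards [ae_hasDerivAt_of_isIntegralCurveOn hφ] with t ht _
      exact ⟨_, by rwa [comb_bracketFrame], le_rfl⟩)
  have hφt : IsTrajectory (bracketFrame X B) x ρ (fun I => u I) φ :=
    ⟨hφ0, fun s hs => by rw [comb_bracketFrame]; exact hφ s hs,
      fun s hs => mem_closedBall_iff_norm.2 (hlt s hs).le⟩
  have := h.norm_trajectory_sub_trajectory_le hu hu hφt hW (s := 1) (by simp)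
  rw [sub_self, norm_zero, mul_zero, norm_le_zero_iff, sub_eq_zero] at this
  exact this

/-- The box has strict bounds, an admissible curve has closed ones and the ball needs distance below
`R`: finiteness of `B` leaves room for some `δ < R`. -/
theorem exists_lt_forall_abs_le_pow {u : MultiIndex n → ℝ} {R : ℝ} (hR : 0 < R)
    (hu : ∀ I ∈ B, |u I| < R ^ weight I) :
    ∃ δ, 0 < δ ∧ δ < R ∧ ∀ I ∈ B, |u I| ≤ δ ^ weight I := by
  have h1 : ∀ᶠ δ in 𝓝[<] R, ∀ I ∈ B, |u I| < δ ^ weight I := by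
    rw [Filter.eventually_all_finset]
    intro I hI
    have hc : Tendsto (fun δ : ℝ => δ ^ weight I) (𝓝[<] R) (𝓝 (R ^ weight I)) :=
      ((continuous_pow _).tendsto R).mono_left nhdsWithin_le_nhds
    exact hc.eventually_const_lt (hu I hI)
  have h2 : ∀ᶠ δ in 𝓝[<] R, 0 < δ :=
    mem_nhdsWithin_of_mem_nhds (lt_mem_nhds hR)
  obtain ⟨δ, ⟨hδ1, hδ2⟩, hδ3⟩ := ((h1.and h2).and self_mem_nhdsWithin).exists
  exact ⟨δ, hδ2, hδ3, fun I hI => (hδ1 I hI).le⟩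

theorem box_subset_subellipticBall (hΩ : IsOpen Ω) (hX : ∀ i, ContDiffOn ℝ ∞ (X i) Ω)
    {S : Finset (MultiIndex n)} (hBS : B ⊆ S) {R : ℝ} (hR : 0 < R) :
    box Ω X B x R ⊆ subellipticBall Ω X S x R := by
  classical
  rintro y ⟨u, hu, φ, hφ0, hφ1, hmem, hφ⟩
  obtain ⟨δ, hδ, hδR, huδ⟩ := exists_lt_forall_abs_le_pow hR hu
  suffices hadm : IsAdmissible Ω X S δ φ by
    have hle : subellipticDist Ω X S x y ≤ ENNReal.ofReal δ :=
      sInf_le ⟨δ, ⟨hδ, φ, hadm, hφ0, hφ1⟩, rfl⟩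
    exact hle.trans_lt ((ENNReal.ofReal_lt_ofReal_iff hR).2 hδR)
  refine ⟨?_, hmem, ?_⟩
  · exact absolutelyContinuousOnInterval_of_isIntegralCurveOn (continuousOn_sum_bracket hΩ hX u)
      hmem hφ
  · refine ⟨fun I _ => if I ∈ B then u I else 0, fun I _ t _ => ?_, ?_⟩
    · dsimp only
      split_ifs with hI
      · exact huδ I hI
      · rw [abs_zero]; positivity
    · filter_upwards [ae_hasDerivAt_of_isIntegralCurveOn hφ] with t ht
      simp only [ite_smul, zero_smul]
      rwa [← Finset.sum_filter, Finset.filter_mem_eq_inter, Finset.inter_eq_right.2 hBS]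

/-- Velocities of admissible curves, written in the frame, have controlled anisotropic size. -/
theorem exists_comb_eq_sum {s : ℕ} {N : ℝ} (hN : 0 ≤ N) (hΩ : IsOpen Ω)
    (hX : ∀ i, ContDiffOn ℝ ∞ (X i) Ω) {z : E} (hz : z ∈ Ω) (hfree : FreeUpToWeightAt X s z)
    (hB : B ⊆ indicesUpTo n s) (hbasis : IsBracketBasisAt X B z)
    (h : LocalFrame (bracketFrame X B) (frameWeight B) x ρ M) (hzx : z ∈ Metric.closedBall x ρ)
    (hbound : ∀ L ∈ indicesUpTo n s, ‖bracket X L z‖ ≤ N) {S : Finset (MultiIndex n)}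
    (hS : S ⊆ indicesUpTo n s) {δ : ℝ} (hδ : 0 < δ) (hδ1 : δ ≤ 1) {a : MultiIndex n → ℝ}
    (ha : ∀ L ∈ S, |a L| ≤ δ ^ weight L) :
    ∃ b : B → ℝ, ∑ L ∈ S, a L • bracket X L z = comb (bracketFrame X B) z b ∧
      ‖dilate (frameWeight B) δ b‖ ≤ (indicesUpTo n s).card * (M * N) := by
  have hM := h.pos
  have hex : ∀ L, ∃ c : B → ℝ, L ∈ indicesUpTo n s →
      bracket X L z = comb (bracketFrame X B) z c ∧ (∀ J : B, |c J| ≤ M * N) ∧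
      ∀ J : B, weight L < frameWeight B J → c J = 0 := by
    intro L
    by_cases hL : L ∈ indicesUpTo n s
    · obtain ⟨c, hc, hc0⟩ := exists_bracket_eq_sum hΩ hX hz hfree hB hbasis hL
      rw [← comb_bracketFrame] at hc
      refine ⟨fun J => c J, fun _ => ⟨hc, fun J => ?_, fun J hJ => hc0 J J.2 hJ⟩⟩
      calc |c J| ≤ ‖fun J : B => c J‖ := norm_le_pi_norm (fun J : B => c J) J
        _ ≤ M * ‖comb (bracketFrame X B) z (fun J => c J)‖ := h.norm_le_comb z hzx _
        _ ≤ M * N := by rw [← hc]; gcongr; exact hbound L hL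
    · exact ⟨0, fun hL' => absurd hL' hL⟩
  choose c hc using hex
  refine ⟨∑ L ∈ S, a L • c L, ?_, ?_⟩
  · rw [map_sum]
    refine Finset.sum_congr rfl fun L hL => ?_
    rw [map_smul, ← (hc L (hS hL)).1]
  · refine norm_dilate_le_of_abs_le hδ (by positivity) fun J => ?_
    have hterm : ∀ L ∈ S, |a L * c L J| ≤ M * N * δ ^ frameWeight B J := by
      intro L hL
      by_cases hw : weight L < frameWeight B J
      · rw [(hc L (hS hL)).2.2 J hw, mul_zero, abs_zero]; positivity
      -- A coefficient can be nonzero only if `|J| ≤ |L|`, and then `δ ^ |L| ≤ δ ^ |J|` because `δ ≤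
      -- 1`.
      · rw [abs_mul, mul_comm]
        exact mul_le_mul ((hc L (hS hL)).2.1 J)
          ((ha L hL).trans (pow_le_pow_of_le_one hδ.le hδ1 (not_lt.1 hw))) (abs_nonneg _)
          (by positivity)
    calc |(∑ L ∈ S, a L • c L) J| = |∑ L ∈ S, a L * c L J| := by simp [Finset.sum_apply]
      _ ≤ ∑ L ∈ S, |a L * c L J| := Finset.abs_sum_le_sum_abs _ _
      _ ≤ ∑ _L ∈ S, M * N * δ ^ frameWeight B J := Finset.sum_le_sum hterm
      _ = S.card * (M * N * δ ^ frameWeight B J) := by rw [Finset.sum_const, nsmul_eq_mul]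
      _ ≤ (indicesUpTo n s).card * (M * N * δ ^ frameWeight B J) := by
        gcongr
      _ = _ := by ring

theorem norm_le_of_forall_abs_lt_pow {s : ℕ} (hB : B ⊆ indicesUpTo n s) {r : ℝ} (hr : 0 < r)
    (hr1 : r ≤ 1) {u : B → ℝ} (hu : ∀ I, |u I| < r ^ frameWeight B I) : ‖u‖ ≤ r :=
  (pi_norm_le_iff_of_nonneg hr.le).2 fun I => (hu I).le.trans
    (pow_le_of_le_one hr.le hr1 (by
      have := weight_pos (mem_indicesUpTo.1 (hB I.2)).1
      unfold frameWeight
      omega))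

/-- The bound on the velocities relative to the scale `δ` of an admissible curve. -/
def HasVelocityBound (X : Fin (n + 1) → E → E) (B S : Finset (MultiIndex n)) (x : E)
    (ρ K : ℝ) : Prop :=
  ∀ z ∈ Metric.closedBall x ρ, ∀ δ : ℝ, 0 < δ → δ ≤ 1 → ∀ a : MultiIndex n → ℝ,
    (∀ L ∈ S, |a L| ≤ δ ^ weight L) →
    ∃ b : B → ℝ, ∑ L ∈ S, a L • bracket X L z = comb (bracketFrame X B) z b ∧
      ‖dilate (frameWeight B) δ b‖ ≤ K

theorem subellipticBall_subset_box [CompleteSpace E] {s : ℕ} (hB : B ⊆ indicesUpTo n s)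
    (h : LocalFrame (bracketFrame X B) (frameWeight B) x ρ M)
    (hball : Metric.closedBall x ρ ⊆ Ω) {S : Finset (MultiIndex n)} {K : ℝ} (hK : 1 ≤ K)
    (hS : HasVelocityBound X B S x ρ K) {R : ℝ}
    (hR : 16 * M * K * R ≤ expRadius ρ M / (4 * M)) :
    subellipticBall Ω X S x R ⊆ box Ω X B x (16 * M * K * R) := by
  intro y hy
  have hM := h.pos
  have hM1 := h.one_le
  have hη := h.expRadius_pos
  have hy' : subellipticDist Ω X S x y < ENNReal.ofReal R := hy
  obtain ⟨_, ⟨δ, ⟨hδ, φ, ⟨hac, hmem, a, ha, hd⟩, hφ0, rfl⟩, rfl⟩, hlt⟩ := sInf_lt_iff.1 hy'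
  have hδR : δ < R := (ENNReal.ofReal_lt_ofReal_iff_of_nonneg hδ.le).1 hlt
  -- At scale `C * δ` the velocity bound `K` becomes `σ = 1/(16M)`, since all weights are at least
  -- 1; then `8 M σ = 1/2 < 1`, as lifting requires.
  set C : ℝ := 16 * M * K with hC
  have hC1 : 1 ≤ C := by nlinarith
  have hCδ : C * δ ≤ expRadius ρ M / (4 * M) := (by gcongr : C * δ ≤ C * R).trans hR
  have hη4 : expRadius ρ M / (4 * M) ≤ 1 := by
    rw [div_le_one (by positivity)]
    have := h.mul_expRadius_le_one
    nlinarith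
  have hCδ1 : C * δ ≤ 1 := hCδ.trans hη4
  have hδ1 : δ ≤ 1 := (le_mul_of_one_le_left hδ.le hC1).trans hCδ1
  choose! W hW using fun u (hu : ‖u‖ ≤ expRadius ρ M) => h.exists_isTrajectory hu
  have hvel : ∀ᵐ t ∂(volume.restrict (Icc (0 : ℝ) 1)), φ t ∈ Metric.closedBall x ρ →
      ∃ b, HasDerivAt φ (comb (bracketFrame X B) (φ t) b) t ∧
        ‖dilate (frameWeight B) δ b‖ ≤ K := by
    filter_upwards [hd, ae_restrict_mem measurableSet_Icc] with t ht htI hball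
    obtain ⟨b, hb, hbK⟩ := hS _ hball δ hδ hδ1 (fun L => a L t) fun L hL => ha L hL t htI
    exact ⟨b, by rwa [← hb], hbK⟩
  have hr : expRadius ρ M / (2 * M) ≤ ρ := by
    rw [div_le_iff₀ (by positivity)]
    have := h.mul_expRadius_le
    nlinarith [h.radius_pos]
  -- Before lifting, the curve has to be confined to the ball covered by the exponential map.
  have hclose := h.norm_curve_sub_lt (β := K * δ) (r := expRadius ρ M / (2 * M)) hac hφ0 hr
    (by positivity) (by
      calc M * (K * δ) = C * δ / 16 := by rw [hC]; ring
        _ ≤ expRadius ρ M / (4 * M) / 16 := by gcongr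
        _ < expRadius ρ M / (2 * M) := by
          have h1 : expRadius ρ M / (2 * M) = 2 * (expRadius ρ M / (4 * M)) := by
            field_simp; norm_num
          have h2 : 0 < expRadius ρ M / (4 * M) := by positivity
          linarith) (by
      filter_upwards [hvel] with t ht hball
      obtain ⟨b, hb, hbK⟩ := ht hball
      refine ⟨b, hb, (pi_norm_le_iff_of_nonneg (by positivity)).2 fun I => ?_⟩
      refine (abs_le_norm_dilate_mul (w := frameWeight B) hδ b I).trans ?_
      gcongr
      exact pow_le_of_le_one hδ.le hδ1 (by
        have := weight_pos (mem_indicesUpTo.1 (hB I.2)).1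
        unfold frameWeight
        omega))
  obtain ⟨u, hu, hudil, hu1⟩ := h.exists_trajectory_one_eq_of_curve (R := C * δ)
    (σ := (16 * M)⁻¹) (by positivity) hCδ1 (by positivity) (by field_simp; norm_num) hW hac hφ0
    (fun t ht => (hclose t ht).le) (by
      filter_upwards [hvel, ae_restrict_mem measurableSet_Icc] with t ht htI
      obtain ⟨b, hb, hbK⟩ := ht (mem_closedBall_iff_norm.2 ((hclose t htI).le.trans hr))
      refine ⟨b, hb, norm_dilate_le_of_abs_le (by positivity) (by positivity) fun I => ?_⟩
      have hw : 1 ≤ frameWeight B I := weight_pos (mem_indicesUpTo.1 (hB I.2)).1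
      calc |b I| ≤ ‖dilate (frameWeight B) δ b‖ * δ ^ frameWeight B I :=
            abs_le_norm_dilate_mul hδ b I
        _ ≤ K * δ ^ frameWeight B I := by gcongr
        _ = (16 * M)⁻¹ * (C * δ ^ frameWeight B I) := by rw [hC]; field_simp
        _ ≤ (16 * M)⁻¹ * (C ^ frameWeight B I * δ ^ frameWeight B I) := by
          gcongr
          exact le_self_pow₀ hC1 (by omega)
        _ = _ := by rw [← mul_pow])
  refine ⟨extendCoeff u, fun I hI => ?_, ?_⟩
  · have h1 := abs_le_norm_dilate_mul (w := frameWeight B) (R := C * δ) (by positivity) u ⟨I, hI⟩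
    have h2 : ‖dilate (frameWeight B) (C * δ) u‖ < 1 :=
      hudil.trans_le (inv_le_one_of_one_le₀ (by linarith))
    rw [show extendCoeff u I = u ⟨I, hI⟩ from extendCoeff_coe u ⟨I, hI⟩]
    calc |u ⟨I, hI⟩| ≤ _ := h1
      _ < 1 * (C * δ) ^ weight I := mul_lt_mul_of_pos_right h2 (by positivity)
      _ ≤ (C * R) ^ weight I := by rw [one_mul]; gcongr
  · have := isExp_of_isTrajectory hball (hW u hu)
    rwa [hu1] at this

end Assembly

/-! ### Volumes of boxes and balls -/

section Measure

variable {p n : ℕ} {Ω : Set (EuclideanSpace ℝ (Fin p))}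
  {X : Fin (n + 1) → EuclideanSpace ℝ (Fin p) → EuclideanSpace ℝ (Fin p)}
  {B : Finset (MultiIndex n)} {x : EuclideanSpace ℝ (Fin p)} {ρ M : ℝ}

theorem volume_setOf_abs_lt_pow (hcard : Fintype.card B = p) {r : ℝ} (hr : 0 < r) :
    volume {u : B → ℝ | ∀ I, |u I| < r ^ frameWeight B I}
      = ENNReal.ofReal (2 ^ p * r ^ (∑ I ∈ B, weight I)) := by
  rw [volume_setOf_abs_lt, ← ENNReal.ofReal_prod_of_nonneg fun _ _ => by positivity,
    Finset.prod_mul_distrib, Finset.prod_const, Finset.card_univ, hcard, Finset.prod_pow_eq_pow_sum,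
    ← Finset.sum_coe_sort B]
  rfl

/-- Since `box` admits every solution in `Ω`, uniqueness of the exponential is needed to place it in
the image of one Lipschitz map. -/
theorem volume_box_le (hΩ : IsOpen Ω) (hX : ∀ i, ContDiffOn ℝ ∞ (X i) Ω) {s : ℕ}
    (hB : B ⊆ indicesUpTo n s) (hcard : Fintype.card B = p)
    (h : LocalFrame (bracketFrame X B) (frameWeight B) x ρ M) {r : ℝ} (hr : 0 < r)
    (hrη : r ≤ expRadius ρ M / 2) (hr1 : r ≤ 1) :
    volume (box Ω X B x r)
      ≤ ENNReal.ofReal ((2 * M) ^ p * 2 ^ p * r ^ (∑ I ∈ B, weight I)) := by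
  have hM := h.pos
  have hη := h.expRadius_pos
  choose! W hW using fun u (hu : ‖u‖ ≤ expRadius ρ M) => h.exists_isTrajectory hu
  have hnorm : ∀ u ∈ {u : B → ℝ | ∀ I, |u I| < r ^ frameWeight B I}, ‖u‖ ≤ r := fun u hu =>
    norm_le_of_forall_abs_lt_pow hB hr hr1 hu
  have hsub : box Ω X B x r
      ⊆ (fun u => W u 1) '' {u : B → ℝ | ∀ I, |u I| < r ^ frameWeight B I} := by
    rintro y ⟨u, hu, hy⟩
    have hmem : (fun I : B => u I) ∈ {u : B → ℝ | ∀ I, |u I| < r ^ frameWeight B I} :=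
      fun I => hu I I.2
    have hle := hnorm _ hmem
    refine ⟨_, hmem, ?_⟩
    refine (eq_trajectory_one_of_isExp hΩ hX h (by linarith) ?_ hy (hW _ (by linarith))).symm
    have := h.mul_expRadius_le
    have := h.radius_pos
    nlinarith
  obtain ⟨K, hK⟩ : ∃ K : ℝ≥0, (K : ℝ) = 2 * M := ⟨⟨2 * M, by positivity⟩, rfl⟩
  have hlip : LipschitzOnWith K (fun u => W u 1)
      {u : B → ℝ | ∀ I, |u I| < r ^ frameWeight B I} := by
    refine LipschitzOnWith.of_dist_le_mul fun u hu v hv => ?_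
    have hu' := hnorm u hu
    have hv' := hnorm v hv
    rw [dist_eq_norm, dist_eq_norm, hK]
    exact h.norm_trajectory_sub_trajectory_le (by linarith) (by linarith) (hW _ (by linarith))
      (hW _ (by linarith)) (by simp)
  refine (measure_mono hsub).trans ((volume_image_le hcard hlip).trans_eq ?_)
  rw [volume_setOf_abs_lt_pow hcard hr, ← ENNReal.ofReal_coe_nnreal, hK,
    ← ENNReal.ofReal_pow (by positivity), ← ENNReal.ofReal_mul (by positivity), mul_assoc]

theorem exists_le_volume_box (p : ℕ) (M : ℝ) (hM : 1 ≤ M) :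
    ∃ c : ℝ, 0 < c ∧ ∀ (n : ℕ) (Ω : Set (EuclideanSpace ℝ (Fin p)))
      (X : Fin (n + 1) → EuclideanSpace ℝ (Fin p) → EuclideanSpace ℝ (Fin p))
      (B : Finset (MultiIndex n)) (s : ℕ) (x : EuclideanSpace ℝ (Fin p)) (ρ r : ℝ),
      B ⊆ indicesUpTo n s → Fintype.card B = p →
      LocalFrame (bracketFrame X B) (frameWeight B) x ρ M → Metric.closedBall x ρ ⊆ Ω →
      0 < r → r ≤ expRadius ρ M → r ≤ 1 →
      ENNReal.ofReal (c * r ^ (∑ I ∈ B, weight I)) ≤ volume (box Ω X B x r) := by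
  obtain ⟨K, hK⟩ : ∃ K : ℝ≥0, (K : ℝ) = 2 * M := ⟨⟨2 * M, by positivity⟩, rfl⟩
  -- The summand 1 keeps `D` positive when `p = 0`.
  set D : ℝ≥0 := K * (p : ℝ≥0) ^ (1 / 2 : ℝ) + 1 with hD
  have hD0 : (0 : ℝ) < D := by rw [hD]; positivity
  refine ⟨2 ^ p / D ^ p, by positivity, fun n Ω X B s x ρ r hB hcard h hball hr hrη hr1 => ?_⟩
  choose! W hW using fun u (hu : ‖u‖ ≤ expRadius ρ M) => h.exists_isTrajectory hu
  set A := {u : B → ℝ | ∀ I, |u I| < r ^ frameWeight B I} with hA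
  have hnorm : ∀ u ∈ A, ‖u‖ ≤ expRadius ρ M := fun u hu =>
    (norm_le_of_forall_abs_lt_pow hB hr hr1 hu).trans hrη
  have hsub : (fun u => W u 1) '' A ⊆ box Ω X B x r := by
    rintro _ ⟨u, hu, rfl⟩
    refine ⟨extendCoeff u, fun I hI => ?_, isExp_of_isTrajectory hball (hW u (hnorm u hu))⟩
    rw [show extendCoeff u I = u ⟨I, hI⟩ from extendCoeff_coe u ⟨I, hI⟩]
    exact hu ⟨I, hI⟩
  have hvol := volume_le_image (K := K) (f := fun u => W u 1) (A := A) hcard fun u hu v hv => by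
    rw [dist_eq_norm, dist_eq_norm, hK]
    exact h.norm_sub_le_trajectory_one (hnorm u hu) (hnorm v hv) (hW _ (hnorm u hu))
      (hW _ (hnorm v hv))
  have hle : volume A ≤ (D : ℝ≥0∞) ^ p * volume (box Ω X B x r) := by
    refine hvol.trans ?_
    gcongr
    · exact le_self_add
  rw [hA, volume_setOf_abs_lt_pow hcard hr] at hle
  have e : ENNReal.ofReal (2 ^ p / (D : ℝ) ^ p * r ^ (∑ I ∈ B, weight I))
      = ENNReal.ofReal (2 ^ p * r ^ (∑ I ∈ B, weight I)) / (D : ℝ≥0∞) ^ p := by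
    rw [← ENNReal.ofReal_coe_nnreal, ← ENNReal.ofReal_pow hD0.le,
      ← ENNReal.ofReal_div_of_pos (by positivity)]
    congr 1
    ring
  rw [e]
  exact ENNReal.div_le_of_le_mul' hle

theorem volume_subellipticBall_le (hΩ : IsOpen Ω) (hX : ∀ i, ContDiffOn ℝ ∞ (X i) Ω) {s : ℕ}
    (hB : B ⊆ indicesUpTo n s) (hcard : Fintype.card B = p)
    (h : LocalFrame (bracketFrame X B) (frameWeight B) x ρ M)
    (hball : Metric.closedBall x ρ ⊆ Ω) {S : Finset (MultiIndex n)} {K : ℝ} (hK : 1 ≤ K)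
    (hS : HasVelocityBound X B S x ρ K) {R : ℝ} (hR : 0 < R)
    (hRη : 16 * M * K * R ≤ expRadius ρ M / (4 * M)) :
    volume (subellipticBall Ω X S x R) ≤ ENNReal.ofReal ((2 * M) ^ p * 2 ^ p *
      (16 * M * K) ^ (∑ I ∈ B, weight I) * R ^ (∑ I ∈ B, weight I)) := by
  have hM := h.pos
  have hη := h.expRadius_pos
  have hη4 : expRadius ρ M / (4 * M) ≤ expRadius ρ M / 2 := by
    gcongr
    linarith [h.one_le]
  have hη1 : expRadius ρ M ≤ 1 := by nlinarith [h.mul_expRadius_le_one, h.one_le]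
  have hpos : 0 < 16 * M * K * R := by positivity
  have hbox := volume_box_le hΩ hX hB hcard h hpos (hRη.trans hη4) (by linarith)
  refine (measure_mono (subellipticBall_subset_box hB h hball hK hS hRη)).trans
    (hbox.trans_eq ?_)
  rw [mul_pow _ R]
  congr 1
  ring

/-- Uniform control, near a compact set, of the frame of basis brackets and of the velocities of
admissible curves. -/
theorem exists_uniform_localFrame (hΩ : IsOpen Ω) (hX : ∀ i, ContDiffOn ℝ ∞ (X i) Ω) {s : ℕ}
    (hfree : ∀ x ∈ Ω, FreeUpToWeightAt X s x) (hB : B ⊆ indicesUpTo n s)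
    (hbasis : ∀ x ∈ Ω, IsBracketBasisAt X B x) {F : Set (EuclideanSpace ℝ (Fin p))}
    (hF : IsCompact F) (hFΩ : F ⊆ Ω) :
    ∃ ρ M K, 1 ≤ M ∧ 0 < ρ ∧ 1 ≤ K ∧ ∀ x ∈ F,
      LocalFrame (bracketFrame X B) (frameWeight B) x ρ M ∧ Metric.closedBall x ρ ⊆ Ω ∧
      ∀ S ⊆ indicesUpTo n s, HasVelocityBound X B S x ρ K := by
  obtain ⟨ρ, M, hKc, hKΩ, hM1, hρ, hframe⟩ := exists_localFrame (w := frameWeight B) hΩ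
    (Y := bracketFrame X B) (fun I => contDiffOn_bracket hΩ hX I)
    (fun z hz => isInvertible_comb_bracketFrame (hbasis z hz)) (fun z hz I K => by
      obtain ⟨c, hc, hc0⟩ := exists_lieBracket_eq_sum hΩ hX hz (hfree z hz) hB (hbasis z hz) I.2 K.2
      exact ⟨fun J => c J, by rw [comb_bracketFrame]; exact hc, fun J hJ => hc0 J J.2 hJ⟩) hF hFΩ
  obtain ⟨N, hN, hbound⟩ : ∃ N, 0 ≤ N ∧ ∀ z ∈ Metric.cthickening ρ F,
      ∀ L ∈ indicesUpTo n s, ‖bracket X L z‖ ≤ N := by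
    choose N hN hb using fun L =>
      exists_nonneg_bound hKc ((contDiffOn_bracket hΩ hX L).continuousOn.mono hKΩ)
    exact ⟨∑ L ∈ indicesUpTo n s, N L, Finset.sum_nonneg fun L _ => hN L, fun z hz L hL =>
      (hb L z hz).trans (Finset.single_le_sum (fun L _ => hN L) hL)⟩
  have hcN : 0 ≤ ((indicesUpTo n s).card : ℝ) * (M * N) := by positivity
  refine ⟨ρ, M, 1 + (indicesUpTo n s).card * (M * N), hM1, hρ, by linarith, fun x hx => ?_⟩
  have hball : Metric.closedBall x ρ ⊆ Metric.cthickening ρ F :=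
    Metric.closedBall_subset_cthickening hx ρ
  refine ⟨hframe x hx, hball.trans hKΩ, fun S hS z hz δ hδ hδ1 a ha => ?_⟩
  have hzΩ := hKΩ (hball hz)
  obtain ⟨b, hb, hbK⟩ := exists_comb_eq_sum hN hΩ hX hzΩ (hfree z hzΩ) hB (hbasis z hzΩ)
    (hframe x hx) hz (hbound z (hball hz)) hS hδ hδ1 ha
  exact ⟨b, hb, hbK.trans (by linarith)⟩

end Measure

end BallBox

/-! ### Choice of the constants -/

theorem mainTheorem10 {p n r : ℕ} (hr : 2 ≤ r)
    -- the smooth vector fields on the domain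
    (Ω : Set (EuclideanSpace ℝ (Fin p))) (hΩ : IsOpen Ω) (hΩc : IsConnected Ω)
    (X : Fin (n + 1) → EuclideanSpace ℝ (Fin p) → EuclideanSpace ℝ (Fin p))
    (hX : ∀ i, ContDiffOn ℝ ∞ (X i) Ω)
    (hfree : ∀ x ∈ Ω, BallBox.FreeUpToWeightAt X r x)
    (hhor : ∀ x ∈ Ω, BallBox.HormanderAt X r x)
    -- the fixed set of multiindices giving a basis at every point
    (B : Finset (BallBox.MultiIndex n)) (hB : B ⊆ BallBox.indicesUpTo n r)
    (hbasis : ∀ x ∈ Ω, BallBox.IsBracketBasisAt X B x)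
    (Ω' : Set (EuclideanSpace ℝ (Fin p)))
    (hΩ'c : IsCompact (closure Ω')) (hΩ' : closure Ω' ⊆ Ω) :
    ∃ C R₀ c₁ c₂ c₃ : ℝ, 1 ≤ C ∧ 0 < R₀ ∧ 0 < c₁ ∧ 0 < c₂ ∧ 0 < c₃ ∧
      ∀ x ∈ Ω', ∀ R : ℝ, 0 < R → R ≤ R₀ →
        -- the exponentials defining the boxes exist
        (∀ u : BallBox.MultiIndex n → ℝ, (∀ I ∈ B, |u I| < (C * R) ^ BallBox.weight I) →
          ∃ y, BallBox.IsExp Ω (fun z => ∑ I ∈ B, u I • BallBox.bracket X I z) x y) ∧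
        -- the distance may be the one induced by `B` or by all `I` with `|I| ≤ r`
        ∀ S : Finset (BallBox.MultiIndex n), (S = B ∨ S = BallBox.indicesUpTo n r) →
          (BallBox.box Ω X B x R ⊆ BallBox.subellipticBall Ω X S x R ∧
            BallBox.subellipticBall Ω X S x R ⊆ BallBox.box Ω X B x (C * R)) ∧
          (ENNReal.ofReal (c₁ * R ^ (∑ I ∈ B, BallBox.weight I))
              ≤ volume (BallBox.subellipticBall Ω X S x R) ∧
            volume (BallBox.subellipticBall Ω X S x R)
              ≤ ENNReal.ofReal (c₂ * R ^ (∑ I ∈ B, BallBox.weight I))) ∧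
          volume (BallBox.subellipticBall Ω X S x (2 * R))
            ≤ ENNReal.ofReal c₃ * volume (BallBox.subellipticBall Ω X S x R) := by
  open BallBox in
  obtain ⟨ρ, M, K, hM1, hρ, hK1, hframe⟩ :=
    exists_uniform_localFrame hΩ hX hfree hB hbasis hΩ'c hΩ'
  have hM : 0 < M := by linarith
  set C : ℝ := 16 * M * K with hC
  have hC1 : 1 ≤ C := by nlinarith
  have hC0 : 0 < C := by linarith
  obtain ⟨c, hc, hlow⟩ := exists_le_volume_box p M hM1
  set Q := ∑ I ∈ B, weight I with hQ
  have hcard : Fintype.card B = p := by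
    obtain ⟨z, hz⟩ := hΩc.nonempty
    rw [card_eq_finrank (hbasis z hz), finrank_euclideanSpace_fin]
  have hη : 0 < expRadius ρ M := by unfold expRadius; positivity
  -- The last division by 2 in `R₀` lets the upper volume bound apply to radius `2R` as well; `c₃`
  -- is the quotient of that bound by the lower one at `R`.
  refine ⟨C, expRadius ρ M / (4 * M) / C / 2, c, (2 * M) ^ p * 2 ^ p * C ^ Q,
    (2 * M) ^ p * 2 ^ p * C ^ Q * 2 ^ Q / c, hC1, by positivity, hc, by positivity, by positivity,
    fun x hx R hR hRR => ?_⟩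
  obtain ⟨h, hball, hvel⟩ := hframe x (subset_closure hx)
  have hCR2 : C * (2 * R) ≤ expRadius ρ M / (4 * M) := by
    have h1 : 2 * R ≤ expRadius ρ M / (4 * M) / C := by linarith
    rw [le_div_iff₀ hC0] at h1
    linarith
  have hη4 : expRadius ρ M / (4 * M) ≤ expRadius ρ M := div_le_self hη.le (by linarith)
  have hη1 : expRadius ρ M ≤ 1 := by nlinarith [h.mul_expRadius_le_one]
  have hCR : C * R ≤ C * (2 * R) := by gcongr; linarith
  have hRC : R ≤ C * R := le_mul_of_one_le_left hR.le hC1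
  refine ⟨fun u hu => ?_, fun S hS => ?_⟩
  · have hle : ‖fun I : B => u I‖ ≤ C * R :=
      norm_le_of_forall_abs_lt_pow hB (by positivity) (by linarith) fun I => hu I I.2
    obtain ⟨W, hW⟩ := h.exists_isTrajectory (u := fun I : B => u I) (by linarith)
    refine ⟨W 1, W, hW.zero, rfl, fun t ht => hball (hW.mem t ht), fun t ht => ?_⟩
    have := hW.deriv t ht
    rwa [comb_bracketFrame] at this
  · have hSsub : S ⊆ indicesUpTo n r := by
      rcases hS with rfl | rfl
      · exact hB
      · exact subset_rfl
    have hBS : B ⊆ S := by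
      rcases hS with rfl | rfl
      · exact subset_rfl
      · exact hB
    have hvS := hvel S hSsub
    have hbox := box_subset_subellipticBall (x := x) hΩ hX hBS hR
    have hlower : ENNReal.ofReal (c * R ^ Q) ≤ volume (subellipticBall Ω X S x R) :=
      (hlow n Ω X B r x ρ R hB hcard h hball hR (by linarith) (by linarith)).trans
        (measure_mono hbox)
    refine ⟨⟨hbox, subellipticBall_subset_box hB h hball hK1 hvS (hCR.trans hCR2)⟩, ⟨hlower,
      volume_subellipticBall_le hΩ hX hB hcard h hball hK1 hvS hR (hCR.trans hCR2)⟩, ?_⟩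
    have h2R : 0 < 2 * R := by linarith
    have hdiv : (2 * M) ^ p * 2 ^ p * C ^ Q * (2 * R) ^ Q
        = (2 * M) ^ p * 2 ^ p * C ^ Q * 2 ^ Q / c * (c * R ^ Q) := by
      rw [mul_pow 2 R]
      field_simp
    have hpos : 0 ≤ (2 * M) ^ p * 2 ^ p * C ^ Q * 2 ^ Q / c := by positivity
    refine (volume_subellipticBall_le hΩ hX hB hcard h hball hK1 hvS h2R hCR2).trans ?_
    rw [← hC, ← hQ, hdiv, ENNReal.ofReal_mul hpos]
    gcongr
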